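/- **Setting.** Let $(X,\mathbf d)$ be a metric space of doubling dimension $d$, i.e. $d$ is the smallest real number such that every closed ball of $X$ can be covered by at most $2^d$ closed balls of half its radius. For finite nonempty $A,B\subseteq X$ let $\mathbf d_h(A,B)=\max_{a\in A}\min_{b\in B}\mathbf d(a,b)$. **Greedy trees.** Fix $\alpha>1$. An enumeration $p_0,\dots,p_{m-1}$ of the $m$ distinct points of $A$, with prefixes $P_i=\{p_0,\dots,p_{i-1}\}$, is an *$\alpha$-approximate greedy permutation* if $\mathbf d(p_i,P_i)\ge\frac1\alpha\max_{p\in A}\mathbf d(p,P_i)$ for $1\le i<m$. An *$\alpha$-scaling predecessor map* sends each $p_i$, $i\ge1$, to some $T(p_i)\in P_i$ with $\varepsilon_{p_i}:=\mathbf d(p_i,T(p_i))\le\alpha\,\mathbf d(p_i,P_i)$ and $\varepsilon_{p_i}\le\frac1\alpha\varepsilon_{T(p_i)}$, where $\varepsilon_{p_0}:=\infty$. The resulting *greedy tree on $A$ with parameter $\alpha$* is the binary tree that starts with one leaf centered at $p_0$ and in which, for $i=1,\dots,m-1$, the leaf centered at $q=T(p_i)$ receives a left child centered at $q$ and a right child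 centered at $p_i$. The radius $\mathrm{rad}(x)$ of a node $x$ is the distance from its center to the farthest center of a leaf below it. Write $\mathbf d_{\mathrm{ctr}}(x,y)$ for the distance between the centers of $x$ and $y$. **Input.** Greedy trees $G_A,G_B$ with parameter $\alpha$ on $A$ and $B$, with the radii stored at the nodes; a real $\varepsilon>0$; and a list of nodes output by a simultaneous radius-order traversal of the two trees: start with a heap holding the two roots and, as long as the heap holds a node of nonzero radius, remove a node of largest radius (ties broken arbitrarily), append it to the list, and put its two children into the heap. **Algorithm Hausdorff.** Maintain a bipartite graph $N$ between nodes of $G_A$ and nodes of $G_B$, with neighbourhoods $N(\cdot)$, stored by adjacency lists, and a number $L$. Initially $N$ is a single edge between the two roots. Updating a node $x$ of $G_A$ means setting $\ell(x):=\max\{\min_{y\in N(x)}(\mathbf d_{\mathrm{ctr}}(x,y)-\mathrm{rad}(y)),0\}$ and $L:=\max\{L,\ell(x)\}$; start with $L=0$ and update the root of $G_A$. For each node $z$ of the list in turn: if $\mathrm{rad}(z)\le\varepsilon L/2$, stop and return $L$. Otherwise replace $z$ in $N$ by its children $z_l,z_r$, both joined to all neighbours of $z$; let $S=\{z_l,z_r\}$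 if $z\in G_A$ and $S=N(z_l)$ if $z\in G_B$; for each $x\in S$ remove every edge $(x,y)$ for which some $y'\in N(x)$ satisfies $\mathbf d_{\mathrm{ctr}}(x,y)-\mathrm{rad}(y)>\mathbf d_{\mathrm{ctr}}(x,y')+2\,\mathrm{rad}(x)$, and then update $x$. When the list is exhausted, return $L$. Time is the number of elementary steps: each call of the distance oracle, operation on or comparison of real numbers, access to memory or to data stored at a node, test, and elementary list operation is one step. (The construction of the trees and of the list is not counted.) **Theorem.** For every $\alpha>1$ there is a constant $C>0$, depending only on $\alpha$, such that for all $X$, $d$, $A$, $B$, $G_A$, $G_B$, lists and $\varepsilon>0$ as above, with $n=|A|+|B|$, the algorithm Hausdorff returns a value $L$ with $$L\le\mathbf d_h(A,B)\le(1+\varepsilon)L$$ after at most $C\left(2+\frac1\varepsilon\right)^{Cd}n$ steps; that is, it runs in $\left(2+\frac1\varepsilon\right)^{O(d)}n$ time. -/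

import Mathlib

universe u v w

/-! ### Doubling dimension and directed Hausdorff distance -/

/-- Every closed ball of `X` can be covered by at most `2 ^ d` closed balls of half its radius. -/
def HalfRadiusCover (X : Type u) [MetricSpace X] (d : ℝ) : Prop :=
  ∀ (c : X) (r : ℝ), 0 ≤ r → ∃ S : Finset X, (S.card : ℝ) ≤ (2 : ℝ) ^ d ∧
    Metric.closedBall c r ⊆ ⋃ s ∈ S, Metric.closedBall s (r / 2)

/-- `d` is the doubling dimension of `X`: the smallest real number with the covering property. -/
def IsDoublingDimension (X : Type u) [MetricSpace X] (d : ℝ) : Prop :=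
  IsLeast {e : ℝ | HalfRadiusCover X e} d

/-- The directed Hausdorff distance `max_{a ∈ A} min_{b ∈ B} dist a b`. -/
noncomputable def directedHausdorff {X : Type u} [MetricSpace X] (A B : Finset X)
    (hA : A.Nonempty) (hB : B.Nonempty) : ℝ :=
  A.sup' hA fun a => B.inf' hB fun b => dist a b

/-! ### Greedy permutations, predecessor maps and greedy trees -/

/-- The distance from `x` to the prefix `{p 0, …, p (i - 1)}`; used for `0 < i` only. -/
noncomputable def prefixDist {X : Type u} [MetricSpace X] (p : ℕ → X) (i : ℕ) (x : X) : ℝ :=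
  Metric.infDist x (p '' Set.Iio i)

/-- `p 0, …, p (|A| - 1)` is an `α`-approximate greedy permutation of `A`. -/
structure IsGreedyPermutation {X : Type u} [MetricSpace X] (α : ℝ) (A : Finset X)
    (p : ℕ → X) : Prop where
  injOn : Set.InjOn p (Set.Iio A.card)
  image_eq : p '' Set.Iio A.card = (A : Set X)
  greedy : ∀ i, 0 < i → i < A.card → ∀ a ∈ A,
    (1 / α) * prefixDist p i a ≤ prefixDist p i (p i)

/-- `p i ↦ p (T i)`, `0 < i < m`, is an `α`-scaling predecessor map for the sequence
`p 0, …, p (m - 1)`: it sends `p i` to an `α`-approximate nearest neighbour in the prefix before it,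
and the insertion distance `dist (p i) (p (T i))` is at most `1 / α` times that of the predecessor
(the insertion distance of `p 0` is infinite). -/
structure IsPredecessorMap {X : Type u} [MetricSpace X] (α : ℝ) (m : ℕ)
    (p : ℕ → X) (T : ℕ → ℕ) : Prop where
  lt : ∀ i, 0 < i → i < m → T i < i
  approx : ∀ i, 0 < i → i < m → dist (p i) (p (T i)) ≤ α * prefixDist p i (p i)
  scaling : ∀ i, 0 < i → i < m → 0 < T i →
    dist (p i) (p (T i)) ≤ (1 / α) * dist (p (T i)) (p (T (T i)))

/-- Binary trees whose nodes carry a center. -/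
inductive BallTree (X : Type u) : Type u
  | leaf (c : X) : BallTree X
  | node (c : X) (l r : BallTree X) : BallTree X

namespace BallTree

/-- The center of the root. -/
def center {X : Type u} : BallTree X → X
  | leaf c => c
  | node c _ _ => c

/-- The largest distance from `a` to a leaf of the tree. -/
noncomputable def maxDist {X : Type u} [MetricSpace X] (a : X) : BallTree X → ℝ
  | leaf c => dist a c
  | node _ l r => max (maxDist a l) (maxDist a r)

/-- The radius of the root: the distance from its center to the farthest leaf. -/
noncomputable def radius {X : Type u} [MetricSpace X] (t : BallTree X) : ℝ :=
  t.maxDist t.center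

open Classical in
/-- Give the leaf centered at `q` a left child centered at `q` and a right child centered at `p`. -/
noncomputable def attach {X : Type u} (q p : X) : BallTree X → BallTree X
  | leaf c => if c = q then node q (leaf q) (leaf p) else leaf c
  | node c l r => node c (attach q p l) (attach q p r)

/-- The tree obtained after inserting `p 0, …, p k`, where `p i` has predecessor `p (T i)`. -/
noncomputable def build {X : Type u} (p : ℕ → X) (T : ℕ → ℕ) : ℕ → BallTree X
  | 0 => leaf (p 0)
  | k + 1 => attach (p (T (k + 1))) (p (k + 1)) (build p T k)

end BallTree

/-- `G` is a greedy tree on `A` with parameter `α`. -/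
def IsGreedyTree {X : Type u} [MetricSpace X] (α : ℝ) (A : Finset X) (G : BallTree X) : Prop :=
  A.Nonempty ∧ ∃ (p : ℕ → X) (T : ℕ → ℕ), IsGreedyPermutation α A p ∧
    IsPredecessorMap α A.card p T ∧ G = BallTree.build p T (A.card - 1)

/-! ### The simultaneous radius-order traversal of two trees -/

/-- Tells whether a node belongs to the tree on `A` or to the tree on `B`. -/
inductive Side : Type
  | inA : Side
  | inB : Side

/-- A node of one of the two greedy trees, given by the subtree below it. The nodes of a greedy
tree have pairwise distinct subtrees, so this determines the node. -/
structure Vertex (X : Type u) : Type u where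
  side : Side
  tree : BallTree X

/-- `RadiusOrder H zs`: the list `zs` is a possible output of the radius-order traversal that starts
with the heap `H`. As long as the heap has a node of nonzero radius, a node of largest radius is
removed from the heap, appended to the output, and replaced by its two children. -/
inductive RadiusOrder {X : Type u} [MetricSpace X] :
    Multiset (Vertex X) → List (Vertex X) → Prop
  | done (H : Multiset (Vertex X)) (h : ∀ v ∈ H, v.tree.radius = 0) : RadiusOrder H []
  | pop (H : Multiset (Vertex X)) (s : Side) (c : X) (l r : BallTree X) (zs : List (Vertex X))
      (hpos : (BallTree.node c l r).radius ≠ 0)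
      (hmax : ∀ v ∈ H, v.tree.radius ≤ (BallTree.node c l r).radius)
      (h : RadiusOrder (⟨s, l⟩ ::ₘ ⟨s, r⟩ ::ₘ H) zs) :
      RadiusOrder (⟨s, BallTree.node c l r⟩ ::ₘ H) (⟨s, BallTree.node c l r⟩ :: zs)

/-! ### The machine: a unit-cost real RAM with a distance oracle -/

/-- The memory: the adjacency lists of the viability graph, the local lower bounds, and the global
lower bound. -/
structure Memory (X : Type u) : Type u where
  adj : Vertex X → List (Vertex X)
  low : Vertex X → ℝ
  best : ℝ

/-- A computation takes a memory to a result, a new memory and the number of executed steps. -/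
def Comp (X : Type u) (β : Type v) : Type (max u v) :=
  Memory X → β × Memory X × ℕ

namespace Comp

/-- Return a value that is already at hand. -/
def ret {X : Type u} {β : Type v} (b : β) : Comp X β := fun M => (b, M, 0)

/-- Sequential composition; the numbers of steps add up. -/
def bind {X : Type u} {β : Type v} {γ : Type w} (m : Comp X β) (f : β → Comp X γ) : Comp X γ :=
  fun M => ((f (m M).1 (m M).2.1).1, (f (m M).1 (m M).2.1).2.1,
    (m M).2.2 + (f (m M).1 (m M).2.1).2.2)

/-- One elementary step. -/
def instr {X : Type u} {β : Type v} (f : Memory X → β × Memory X) : Comp X β :=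
  fun M => ((f M).1, (f M).2, 1)

/-- One elementary step that does not change the memory. -/
def query {X : Type u} {β : Type v} (b : β) : Comp X β := instr fun M => (b, M)

end Comp

infixl:55 " ≫= " => Comp.bind

namespace Hausdorff

open Comp

/-! Elementary steps. Every access to the memory or to the data stored at a node (side, center,
radius, children), every call of the distance oracle, every operation on real numbers, every test
and every list operation (taking a list apart, prepending an element) is one step. -/

/-- Taking a list apart. -/
def tick {X : Type u} : Comp X Unit := query ()

def getSide {X : Type u} (v : Vertex X) : Comp X Side := query v.side

def getCenter {X : Type u} (v : Vertex X) : Comp X X := query v.tree.center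

/-- The radii are stored with the nodes. -/
noncomputable def getRadius {X : Type u} [MetricSpace X] (v : Vertex X) : Comp X ℝ :=
  query v.tree.radius

def getChildren {X : Type u} (v : Vertex X) : Comp X (Option (Vertex X × Vertex X)) :=
  query (match v.tree with
    | .leaf _ => none
    | .node _ l r => some (⟨v.side, l⟩, ⟨v.side, r⟩))

noncomputable def distance {X : Type u} [MetricSpace X] (a b : X) : Comp X ℝ := query (dist a b)

noncomputable def add {X : Type u} (a b : ℝ) : Comp X ℝ := query (a + b)

noncomputable def sub {X : Type u} (a b : ℝ) : Comp X ℝ := query (a - b)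

noncomputable def mul {X : Type u} (a b : ℝ) : Comp X ℝ := query (a * b)

noncomputable def half {X : Type u} (a : ℝ) : Comp X ℝ := query (a / 2)

noncomputable def minimum {X : Type u} (a b : ℝ) : Comp X ℝ := query (min a b)

noncomputable def maximum {X : Type u} (a b : ℝ) : Comp X ℝ := query (max a b)

open Classical in
noncomputable def lessThan {X : Type u} (a b : ℝ) : Comp X Bool := query (decide (a < b))

open Classical in
noncomputable def atMost {X : Type u} (a b : ℝ) : Comp X Bool := query (decide (a ≤ b))

open Classical in
noncomputable def same {X : Type u} (v w : Vertex X) : Comp X Bool := query (decide (v = w))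

def prepend {X : Type u} (v : Vertex X) (l : List (Vertex X)) : Comp X (List (Vertex X)) :=
  query (v :: l)

def getAdj {X : Type u} (v : Vertex X) : Comp X (List (Vertex X)) := instr fun M => (M.adj v, M)

open Classical in
noncomputable def setAdj {X : Type u} (v : Vertex X) (l : List (Vertex X)) : Comp X Unit :=
  instr fun M => ((), { M with adj := Function.update M.adj v l })

open Classical in
noncomputable def setLow {X : Type u} (v : Vertex X) (a : ℝ) : Comp X Unit :=
  instr fun M => ((), { M with low := Function.update M.low v a })

def getBest {X : Type u} : Comp X ℝ := instr fun M => (M.best, M)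

def setBest {X : Type u} (a : ℝ) : Comp X Unit := instr fun M => ((), { M with best := a })

/-! The program. -/

/-- Run `f` on every element of a list. -/
def forEach {X : Type u} (f : Vertex X → Comp X Unit) : List (Vertex X) → Comp X Unit
  | [] => tick
  | v :: vs => tick ≫= fun _ => f v ≫= fun _ => forEach f vs

/-- The minimum of the values of `f` on a nonempty list. -/
noncomputable def minOver {X : Type u} (f : Vertex X → Comp X ℝ) : List (Vertex X) → Comp X ℝ
  | [] => tick ≫= fun _ => ret 0
  | [v] => tick ≫= fun _ => f v
  | v :: v' :: vs => tick ≫= fun _ => f v ≫= fun a =>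
      minOver f (v' :: vs) ≫= fun b => minimum a b

/-- Delete `x` from a list. -/
noncomputable def deleteFrom {X : Type u} (x : Vertex X) :
    List (Vertex X) → Comp X (List (Vertex X))
  | [] => tick ≫= fun _ => ret []
  | v :: vs => tick ≫= fun _ => same v x ≫= fun e =>
      if e then deleteFrom x vs
      else deleteFrom x vs ≫= fun vs' => prepend v vs'

/-- The distance between the centers of two nodes. -/
noncomputable def centerDist {X : Type u} [MetricSpace X] (x y : Vertex X) : Comp X ℝ :=
  getCenter x ≫= fun a => getCenter y ≫= fun b => distance a b

/-- The distance between the centers of `x` and `y` minus the radius of `y`. -/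
noncomputable def gap {X : Type u} [MetricSpace X] (x y : Vertex X) : Comp X ℝ :=
  centerDist x y ≫= fun a => getRadius y ≫= fun ρ => sub a ρ

/-- `ℓ(x) := max (min_{y ∈ N(x)} (centerDist x y - radius y)) 0` and `L := max L ℓ(x)`. -/
noncomputable def updateLow {X : Type u} [MetricSpace X] (x : Vertex X) : Comp X Unit :=
  getAdj x ≫= fun ys => minOver (gap x) ys ≫= fun m => maximum m 0 ≫= fun a =>
    setLow x a ≫= fun _ => getBest ≫= fun b => maximum b a ≫= fun b' => setBest b'

/-- Remove the edge between `x` and each listed `y` with `centerDist x y - radius y > t`; the result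
is the list of the `y` that are kept. -/
noncomputable def pruneAbove {X : Type u} [MetricSpace X] (x : Vertex X) (t : ℝ) :
    List (Vertex X) → Comp X (List (Vertex X))
  | [] => tick ≫= fun _ => ret []
  | y :: ys => tick ≫= fun _ => gap x y ≫= fun g => lessThan t g ≫= fun e =>
      if e then
        getAdj y ≫= fun xs => deleteFrom x xs ≫= fun xs' => setAdj y xs' ≫= fun _ =>
          pruneAbove x t ys
      else pruneAbove x t ys ≫= fun ys' => prepend y ys'

/-- Prune `x`: remove every edge `(x, y)` for which some `y' ∈ N(x)` satisfies
`centerDist x y - radius y > centerDist x y' + 2 * radius x`. -/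
noncomputable def prune {X : Type u} [MetricSpace X] (x : Vertex X) : Comp X Unit :=
  getAdj x ≫= fun ys => minOver (centerDist x) ys ≫= fun m => getRadius x ≫= fun ρ =>
    add ρ ρ ≫= fun ρ2 => add m ρ2 ≫= fun t => pruneAbove x t ys ≫= fun ys' => setAdj x ys'

/-- In the adjacency list of `v`, replace `z` by its children. -/
noncomputable def replaceIn {X : Type u} (z zl zr v : Vertex X) : Comp X Unit :=
  getAdj v ≫= fun ws => deleteFrom z ws ≫= fun ws' => prepend zr ws' ≫= fun ws₁ =>
    prepend zl ws₁ ≫= fun ws₂ => setAdj v ws₂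

/-- Replace `z` by its children in the viability graph, joining them to all the neighbours of `z`;
the result is the list of the neighbours. -/
noncomputable def splitVertex {X : Type u} (z zl zr : Vertex X) : Comp X (List (Vertex X)) :=
  getAdj z ≫= fun ns => setAdj zl ns ≫= fun _ => setAdj zr ns ≫= fun _ =>
    forEach (replaceIn z zl zr) ns ≫= fun _ => setAdj z [] ≫= fun _ => ret ns

/-- The nodes to be pruned after `z` has been split. -/
def affected {X : Type u} (z zl zr : Vertex X) (ns : List (Vertex X)) :
    Comp X (List (Vertex X)) :=
  getSide z ≫= fun s =>
    match s with
    | .inA => prepend zr [] ≫= fun l => prepend zl l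
    | .inB => ret ns

/-- The main loop. -/
noncomputable def mainLoop {X : Type u} [MetricSpace X] (ε : ℝ) : List (Vertex X) → Comp X ℝ
  | [] => tick ≫= fun _ => getBest
  | z :: zs => tick ≫= fun _ => getRadius z ≫= fun r => getBest ≫= fun L =>
      mul ε L ≫= fun a => half a ≫= fun t => atMost r t ≫= fun finished =>
        if finished then ret L
        else getChildren z ≫= fun ch =>
          match ch with
          | none => ret L
          | some (zl, zr) =>
            splitVertex z zl zr ≫= fun ns => affected z zl zr ns ≫= fun S =>
              forEach (fun x => prune x ≫= fun _ => updateLow x) S ≫= fun _ =>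
                mainLoop ε zs

/-- The whole algorithm. The input consists of the two trees, of the list `zs` of their
nodes in the order of the simultaneous radius-order traversal, and of `ε`. -/
noncomputable def program {X : Type u} [MetricSpace X] (ε : ℝ) (GA GB : BallTree X)
    (zs : List (Vertex X)) : Comp X ℝ :=
  prepend ⟨.inB, GB⟩ [] ≫= fun ys => setAdj ⟨.inA, GA⟩ ys ≫= fun _ =>
    prepend ⟨.inA, GA⟩ [] ≫= fun xs => setAdj ⟨.inB, GB⟩ xs ≫= fun _ =>
      setBest 0 ≫= fun _ => updateLow ⟨.inA, GA⟩ ≫= fun _ => mainLoop ε zs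

/-- The memory before the start. -/
def blank (X : Type u) : Memory X := ⟨fun _ => [], fun _ => 0, 0⟩

/-- The value returned by the algorithm. -/
noncomputable def output {X : Type u} [MetricSpace X] (ε : ℝ) (GA GB : BallTree X)
    (zs : List (Vertex X)) : ℝ :=
  (program ε GA GB zs (blank X)).1

/-- The number of steps executed by the algorithm. -/
noncomputable def runningTime {X : Type u} [MetricSpace X] (ε : ℝ) (GA GB : BallTree X)
    (zs : List (Vertex X)) : ℕ :=
  (program ε GA GB zs (blank X)).2.2

end Hausdorff

/-!
The heap always partitions `A` and `B`. For `a ∈ A` below a node `x` of the heap, some neighbour of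
`x` lies above each nearest point of `a` in `B`, since pruning only removes nodes that are too far
away. Hence every `ℓ(x)` is a lower bound for the distance from the center of `x` to `B`, which
gives `L ≤ d_h(A, B)`, and `d_h(A, B) ≤ L + 2 * r`, where `r` is the largest radius in the heap; the
loop stops when `2 * r ≤ ε * L` or `r = 0`.

For the running time, the insertion distances along a branch of a greedy tree decay geometrically,
so the centers of the heap are at least of order `r` apart on each side. A node has its neighbours
at distance at most `L + 4 * r`, which is at most `(2 / ε + 4) * r` as long as the loop goes on.
Packing then bounds the degrees by `(O(1) * (2 + 1 / ε)) ^ d`, and one iteration costs at most a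
cubic polynomial in this bound.
-/

/-! ### Packing in doubling spaces -/

namespace HalfRadiusCover

variable {X : Type u} [MetricSpace X] {d : ℝ}

theorem exists_cover (h : HalfRadiusCover X d) (k : ℕ) (c : X) {r : ℝ} (hr : 0 ≤ r) :
    ∃ S : Finset X, (S.card : ℝ) ≤ ((2 : ℝ) ^ d) ^ k ∧
      Metric.closedBall c r ⊆ ⋃ s ∈ S, Metric.closedBall s (r / 2 ^ k) := by
  classical
  induction k with
  | zero => exact ⟨{c}, by simp, by simp⟩
  | succ k ih =>
    obtain ⟨S, hS, hcov⟩ := ih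
    choose F hF hFc using fun s => h s (r / 2 ^ k) (by positivity)
    refine ⟨S.biUnion F, ?_, fun x hx => ?_⟩
    · calc ((S.biUnion F).card : ℝ) ≤ ∑ s ∈ S, ((F s).card : ℝ) := by
            exact_mod_cast Finset.card_biUnion_le
        _ ≤ ∑ _s ∈ S, (2 : ℝ) ^ d := Finset.sum_le_sum fun s _ => hF s
        _ = S.card * (2 : ℝ) ^ d := by simp
        _ ≤ ((2 : ℝ) ^ d) ^ k * (2 : ℝ) ^ d := by gcongr
        _ = ((2 : ℝ) ^ d) ^ (k + 1) := (pow_succ _ _).symm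
    · obtain ⟨s, hs, hxs⟩ := Set.mem_iUnion₂.1 (hcov hx)
      obtain ⟨t, ht, hxt⟩ := Set.mem_iUnion₂.1 (hFc s hxs)
      refine Set.mem_iUnion₂.2 ⟨t, Finset.mem_biUnion.2 ⟨s, hs, ht⟩, ?_⟩
      rwa [pow_succ, ← div_div]

theorem nonneg [Nonempty X] (h : HalfRadiusCover X d) : 0 ≤ d := by
  obtain ⟨S, hS, hcov⟩ := h (Classical.arbitrary X) 0 le_rfl
  have hne : S.Nonempty := by
    rw [Finset.nonempty_iff_ne_empty]
    rintro rfl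
    simpa using hcov (Metric.mem_closedBall_self le_rfl)
  by_contra! hd
  have hcard : (1 : ℝ) ≤ S.card := by exact_mod_cast hne.card_pos
  exact (hcard.trans hS).not_gt (Real.rpow_lt_one_of_one_lt_of_neg one_lt_two hd)

theorem card_le_of_separated (h : HalfRadiusCover X d) {S : Finset X} {c : X} {r s q : ℝ}
    (hr : 0 ≤ r) (hs : 0 < s) (hq : 1 ≤ 2 * q) (hrs : r ≤ q * s) (hS : ∀ x ∈ S, dist x c ≤ r)
    (hsep : (S : Set X).Pairwise fun x y => s ≤ dist x y) : (S.card : ℝ) ≤ (4 * q) ^ d := by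
  have : Nonempty X := ⟨c⟩
  obtain ⟨k, hk, hk'⟩ := exists_nat_pow_near hq (one_lt_two : (1 : ℝ) < 2)
  obtain ⟨F, hF, hcov⟩ := h.exists_cover (k + 1) c hr
  have hex : ∀ x ∈ S, ∃ f ∈ F, dist x f ≤ r / 2 ^ (k + 1) := fun x hx => by
    simpa using hcov (Metric.mem_closedBall.2 (hS x hx))
  choose! f hfF hf using hex
  have hsmall : r / 2 ^ (k + 1) < s / 2 := by
    rw [div_lt_div_iff₀ (by positivity) two_pos]
    nlinarith
  have hinj : Set.InjOn f S := fun x hx y hy hxy => by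
    by_contra hne
    have hyx := hf y hy
    rw [← hxy] at hyx
    linarith [hsep hx hy hne, hf x hx, dist_triangle_right x y (f x)]
  calc (S.card : ℝ) ≤ F.card := by exact_mod_cast Finset.card_le_card_of_injOn f hfF hinj
    _ ≤ ((2 : ℝ) ^ d) ^ (k + 1) := hF
    _ = ((2 : ℝ) ^ (k + 1)) ^ d := by
        rw [← Real.rpow_natCast, ← Real.rpow_natCast, ← Real.rpow_mul two_pos.le,
          ← Real.rpow_mul two_pos.le, mul_comm]
    _ ≤ (4 * q) ^ d := by
        refine Real.rpow_le_rpow (by positivity) ?_ h.nonneg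
        rw [pow_succ]
        linarith

end HalfRadiusCover

/-! ### Radii in ball trees -/

namespace BallTree

variable {X : Type u}

/-- The centers of the leaves, with multiplicities. -/
def leaves : BallTree X → Multiset X
  | leaf c => {c}
  | node _ l r => leaves l + leaves r

theorem card_leaves_pos (t : BallTree X) : 0 < t.leaves.card := by
  induction t with
  | leaf c => simp [leaves]
  | node c l r hl _ => simp [leaves, hl]

section Radius

variable [MetricSpace X]

theorem dist_le_maxDist (a : X) {t : BallTree X} {x : X} (hx : x ∈ t.leaves) :
    dist a x ≤ t.maxDist a := by
  induction t with
  | leaf c => rw [Multiset.mem_singleton.1 hx, maxDist]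
  | node c l r hl hr =>
    rcases Multiset.mem_add.1 hx with h | h
    · exact (hl h).trans (le_max_left _ _)
    · exact (hr h).trans (le_max_right _ _)

theorem exists_maxDist_eq (a : X) (t : BallTree X) : ∃ x ∈ t.leaves, t.maxDist a = dist a x := by
  induction t with
  | leaf c => exact ⟨c, Multiset.mem_singleton_self c, rfl⟩
  | node c l r hl hr =>
    obtain ⟨x, hx, hx'⟩ := hl
    obtain ⟨y, hy, hy'⟩ := hr
    rcases max_choice (maxDist a l) (maxDist a r) with h | h
    · exact ⟨x, Multiset.mem_add.2 (.inl hx), by rw [maxDist, h, hx']⟩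
    · exact ⟨y, Multiset.mem_add.2 (.inr hy), by rw [maxDist, h, hy']⟩

theorem dist_center_le_radius {t : BallTree X} {x : X} (hx : x ∈ t.leaves) :
    dist t.center x ≤ t.radius :=
  dist_le_maxDist _ hx

theorem radius_nonneg (t : BallTree X) : 0 ≤ t.radius := by
  obtain ⟨x, -, h⟩ := t.exists_maxDist_eq t.center
  exact dist_nonneg.trans_eq h.symm

theorem dist_le_two_mul_radius {t : BallTree X} {x y : X} (hx : x ∈ t.leaves)
    (hy : y ∈ t.leaves) : dist x y ≤ 2 * t.radius := by
  linarith [dist_triangle_left x y t.center, dist_center_le_radius hx, dist_center_le_radius hy]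

end Radius

/-- Every internal node has the center of its left child. -/
def IsCentered : BallTree X → Prop
  | leaf _ => True
  | node c l r => l.center = c ∧ l.IsCentered ∧ r.IsCentered

theorem IsCentered.center_mem_leaves {t : BallTree X} (ht : t.IsCentered) :
    t.center ∈ t.leaves := by
  induction t with
  | leaf c => exact Multiset.mem_singleton_self c
  | node c l r hl _ => exact Multiset.mem_add.2 (.inl (ht.1 ▸ hl ht.2.1))

/-! ### Greedy trees -/

theorem center_attach (q p : X) (t : BallTree X) : (attach q p t).center = t.center := by
  cases t with
  | leaf c => by_cases h : c = q <;> simp [attach, h, center]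
  | node c l r => rfl

theorem IsCentered.attach {t : BallTree X} (ht : t.IsCentered) (q p : X) :
    (attach q p t).IsCentered := by
  induction t with
  | leaf c => by_cases h : c = q <;> simp [BallTree.attach, h, IsCentered, center]
  | node c l r hl hr => exact ⟨(center_attach q p l).trans ht.1, hl ht.2.1, hr ht.2.2⟩

open Classical in
theorem leaves_attach (q p : X) (t : BallTree X) :
    (attach q p t).leaves = t.leaves + Multiset.replicate (t.leaves.count q) p := by
  induction t with
  | leaf c =>
    by_cases h : c = q
    · simp [attach, h, leaves]
    · simp [attach, h, leaves, Ne.symm h]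
  | node c l r hl hr =>
    simp only [attach, leaves, hl, hr, Multiset.count_add, Multiset.replicate_add]
    ac_rfl

theorem mem_leaves_attach {q p x : X} {t : BallTree X} :
    x ∈ (attach q p t).leaves ↔ x ∈ t.leaves ∨ (q ∈ t.leaves ∧ x = p) := by
  classical
  rw [leaves_attach, Multiset.mem_add, Multiset.mem_replicate, Multiset.count_ne_zero]

theorem center_build (p : ℕ → X) (T : ℕ → ℕ) (k : ℕ) : (build p T k).center = p 0 := by
  induction k with
  | zero => rfl
  | succ k ih => rw [build, center_attach, ih]

theorem isCentered_build (p : ℕ → X) (T : ℕ → ℕ) (k : ℕ) : (build p T k).IsCentered := by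
  induction k with
  | zero => trivial
  | succ k ih => exact ih.attach _ _

theorem leaves_build {p : ℕ → X} {T : ℕ → ℕ} {m : ℕ} (hp : Set.InjOn p (Set.Iio m))
    (hT : ∀ i, 0 < i → i < m → T i < i) {k : ℕ} (hk : k < m) :
    (build p T k).leaves = (Multiset.range (k + 1)).map p := by
  classical
  induction k with
  | zero => simp [build, leaves]
  | succ k ih =>
    have hmem : p (T (k + 1)) ∈ (Multiset.range (k + 1)).map p :=
      Multiset.mem_map_of_mem p (Multiset.mem_range.2 (hT _ k.succ_pos hk))
    have hnodup : ((Multiset.range (k + 1)).map p).Nodup := by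
      refine Multiset.Nodup.map_on (fun x hx y hy => ?_) (Multiset.nodup_range _)
      exact hp ((Multiset.mem_range.1 hx).trans hk) ((Multiset.mem_range.1 hy).trans hk)
    rw [build, leaves_attach, ih (by lia), Multiset.count_eq_one_of_mem hnodup hmem,
      Multiset.range_succ (k + 1), Multiset.map_cons, Multiset.replicate_one, add_comm,
      Multiset.singleton_add]

end BallTree

section InsertionDistance

variable {X : Type u} [MetricSpace X] {α : ℝ} {A : Finset X} {p : ℕ → X} {T : ℕ → ℕ}

/-- The insertion distance of the `j`-th point, for `0 < j`. -/
noncomputable def insertionDist (p : ℕ → X) (T : ℕ → ℕ) (j : ℕ) : ℝ := dist (p j) (p (T j))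

theorem insertionDist_nonneg (p : ℕ → X) (T : ℕ → ℕ) (j : ℕ) : 0 ≤ insertionDist p T j :=
  dist_nonneg

theorem insertionDist_le_sq_mul_prefixDist (hα : 0 < α) (hp : IsGreedyPermutation α A p)
    (hT : IsPredecessorMap α A.card p T) {i k : ℕ} (hi : 0 < i) (hik : i ≤ k) (hk : k < A.card) :
    insertionDist p T k ≤ α ^ 2 * prefixDist p i (p i) := by
  have hmem : p k ∈ A := by
    have : p k ∈ (A : Set X) := hp.image_eq ▸ Set.mem_image_of_mem p hk
    exact this
  have hanti : prefixDist p k (p k) ≤ prefixDist p i (p k) :=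
    Metric.infDist_le_infDist_of_subset (Set.image_mono (Set.Iio_subset_Iio hik))
      ⟨p 0, Set.mem_image_of_mem p hi⟩
  have hgreedy : prefixDist p i (p k) ≤ α * prefixDist p i (p i) := by
    have := hp.greedy i hi (hik.trans_lt hk) (p k) hmem
    rwa [one_div, inv_mul_le_iff₀ hα] at this
  calc insertionDist p T k ≤ α * prefixDist p k (p k) := hT.approx k (hi.trans_le hik) hk
    _ ≤ α * (α * prefixDist p i (p i)) := by gcongr; exact hanti.trans hgreedy
    _ = α ^ 2 * prefixDist p i (p i) := by ring

/-- `x` is `c` or one of the points `p 1, …, p k`, at a distance from `c` that leaves room below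
`α ^ 3 / (α - 1) * prefixDist p i (p i)` for the geometric series of the insertion distances of the
points inserted below `x`. -/
def IsTracedTo (α : ℝ) (p : ℕ → X) (T : ℕ → ℕ) (k i : ℕ) (c x : X) : Prop :=
  x = c ∨ ∃ j, 0 < j ∧ j ≤ k ∧ x = p j ∧
    dist c x + insertionDist p T j / (α - 1) ≤ α ^ 3 / (α - 1) * prefixDist p i (p i)

theorem IsTracedTo.mono {k k' i : ℕ} {c x : X} (h : IsTracedTo α p T k i c x) (hk : k ≤ k') :
    IsTracedTo α p T k' i c x :=
  h.imp_right fun ⟨j, hj, hjk, hx⟩ => ⟨j, hj, hjk.trans hk, hx⟩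

theorem IsTracedTo.dist_le (hα : 1 < α) {k i : ℕ} {c x : X} (h : IsTracedTo α p T k i c x) :
    dist c x ≤ α ^ 3 / (α - 1) * prefixDist p i (p i) := by
  have hα' : 0 < α - 1 := by linarith
  rcases h with rfl | ⟨j, -, -, -, hj⟩
  · have : 0 ≤ prefixDist p i (p i) := Metric.infDist_nonneg
    rw [dist_self]
    positivity
  · have : 0 ≤ insertionDist p T j / (α - 1) := div_nonneg (insertionDist_nonneg p T j) hα'.le
    linarith

theorem isTracedTo_predecessor (hα : 1 < α) (hp : IsGreedyPermutation α A p)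
    (hT : IsPredecessorMap α A.card p T) {k i : ℕ} (hi : 0 < i) (hik : i ≤ k) (hk : k < A.card) :
    IsTracedTo α p T k i (p (T k)) (p k) := by
  have hα' : 0 < α - 1 := by linarith
  refine .inr ⟨k, hi.trans_le hik, le_rfl, rfl, ?_⟩
  calc dist (p (T k)) (p k) + insertionDist p T k / (α - 1)
      = α / (α - 1) * insertionDist p T k := by
        rw [dist_comm, ← insertionDist]
        field_simp
        ring
    _ ≤ α / (α - 1) * (α ^ 2 * prefixDist p i (p i)) := by
        gcongr
        exact insertionDist_le_sq_mul_prefixDist (by linarith) hp hT hi hik hk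
    _ = α ^ 3 / (α - 1) * prefixDist p i (p i) := by ring

theorem IsTracedTo.succ (hα : 1 < α) (hp : IsGreedyPermutation α A p)
    (hT : IsPredecessorMap α A.card p T) {k i : ℕ} {c : X} (hi : 0 < i) (hik : i ≤ k + 1)
    (hk : k + 1 < A.card) (h : IsTracedTo α p T k i c (p (T (k + 1)))) :
    IsTracedTo α p T (k + 1) i c (p (k + 1)) := by
  have hα' : 0 < α - 1 := by linarith
  rcases h with rfl | ⟨j, hj, hjk, hpj, hle⟩
  · exact isTracedTo_predecessor hα hp hT hi hik hk
  refine .inr ⟨k + 1, k.succ_pos, le_rfl, rfl, ?_⟩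
  have hTj : T (k + 1) = j :=
    hp.injOn ((hT.lt _ k.succ_pos hk).trans hk) (hjk.trans_lt (k.lt_succ_self.trans hk)) hpj
  subst hTj
  have hscaling : α * insertionDist p T (k + 1) ≤ insertionDist p T (T (k + 1)) := by
    have := hT.scaling (k + 1) k.succ_pos hk hj
    rwa [one_div, ← div_eq_inv_mul, le_div_iff₀' (by linarith)] at this
  calc dist c (p (k + 1)) + insertionDist p T (k + 1) / (α - 1)
      ≤ dist c (p (T (k + 1))) + insertionDist p T (k + 1)
          + insertionDist p T (k + 1) / (α - 1) := by
        rw [insertionDist, dist_comm (p (k + 1))]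
        gcongr
        exact dist_triangle _ _ _
    _ = dist c (p (T (k + 1))) + α * insertionDist p T (k + 1) / (α - 1) := by
        field_simp
        ring
    _ ≤ dist c (p (T (k + 1))) + insertionDist p T (T (k + 1)) / (α - 1) := by gcongr
    _ ≤ α ^ 3 / (α - 1) * prefixDist p i (p i) := hle

end InsertionDistance

namespace BallTree

variable {X : Type u} [MetricSpace X] {α κ : ℝ} {A : Finset X} {p : ℕ → X} {T : ℕ → ℕ}

/-- In every internal node, all leaves are traced to the center, relative to the index `i` of the
point `p i` at which the right child is centered. -/
def IsTraced (α : ℝ) (p : ℕ → X) (T : ℕ → ℕ) (k : ℕ) : BallTree X → Prop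
  | leaf _ => True
  | node c l r => (∃ i, 0 < i ∧ i ≤ k ∧ r.center = p i ∧
      ∀ x ∈ (node c l r).leaves, IsTracedTo α p T k i c x) ∧
      l.IsTraced α p T k ∧ r.IsTraced α p T k

theorem IsTraced.attach (hα : 1 < α) (hp : IsGreedyPermutation α A p)
    (hT : IsPredecessorMap α A.card p T) {k : ℕ} (hk : k + 1 < A.card) {t : BallTree X}
    (ht : t.IsTraced α p T k) :
    (attach (p (T (k + 1))) (p (k + 1)) t).IsTraced α p T (k + 1) := by
  induction t with
  | leaf c =>
    by_cases h : c = p (T (k + 1))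
    · simp only [BallTree.attach, h, if_true, IsTraced, and_true]
      refine ⟨k + 1, k.succ_pos, le_rfl, rfl, fun x hx => ?_⟩
      simp only [leaves, Multiset.mem_add, Multiset.mem_singleton] at hx
      rcases hx with rfl | rfl
      · exact .inl rfl
      · exact isTracedTo_predecessor hα hp hT k.succ_pos le_rfl hk
    · simp [BallTree.attach, h, IsTraced]
  | node c l r hl hr =>
    obtain ⟨⟨i, hi, hik, hri, htraced⟩, hl', hr'⟩ := ht
    refine ⟨⟨i, hi, hik.trans k.le_succ, by rw [center_attach, hri], fun x hx => ?_⟩,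
      hl hl', hr hr'⟩
    rcases mem_leaves_attach (t := node c l r).1 hx with hx | ⟨hq, rfl⟩
    · exact (htraced x hx).mono k.le_succ
    · exact (htraced _ hq).succ hα hp hT hi (hik.trans k.le_succ) hk

theorem isTraced_build (hα : 1 < α) (hp : IsGreedyPermutation α A p)
    (hT : IsPredecessorMap α A.card p T) {k : ℕ} (hk : k < A.card) :
    (build p T k).IsTraced α p T k := by
  induction k with
  | zero => trivial
  | succ k ih => exact (ih (k.lt_succ_self.trans hk)).attach hα hp hT hk

/-- Every right child is centered at a point `p i` whose distance to the prefix before it is at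
least the radius of its parent, up to the factor `κ`. -/
def IsSpread (p : ℕ → X) (κ : ℝ) : BallTree X → Prop
  | leaf _ => True
  | node c l r => (∃ i, r.center = p i ∧ (node c l r).radius ≤ κ * prefixDist p i (p i)) ∧
      l.IsSpread p κ ∧ r.IsSpread p κ

theorem IsTraced.isSpread (hα : 1 < α) {k : ℕ} {t : BallTree X} (ht : t.IsTraced α p T k) :
    t.IsSpread p (α ^ 3 / (α - 1)) := by
  induction t with
  | leaf c => trivial
  | node c l r hl hr =>
    obtain ⟨⟨i, -, -, hri, htraced⟩, hl', hr'⟩ := ht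
    refine ⟨⟨i, hri, ?_⟩, hl hl', hr hr'⟩
    obtain ⟨x, hx, hradius⟩ := (node c l r).exists_maxDist_eq c
    exact hradius.trans_le ((htraced x hx).dist_le hα)

end BallTree

namespace IsGreedyTree

variable {X : Type u} [MetricSpace X] {α : ℝ} {A : Finset X} {G : BallTree X}

theorem leaves_eq (h : IsGreedyTree α A G) : G.leaves = A.val := by
  obtain ⟨hA, p, T, hp, hT, rfl⟩ := h
  have hpos := hA.card_pos
  rw [BallTree.leaves_build hp.injOn hT.lt (by lia), Nat.sub_add_cancel hpos]
  refine (Multiset.Nodup.ext (Multiset.Nodup.map_on (fun x hx y hy => ?_)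
    (Multiset.nodup_range _)) A.nodup).2 fun a => ?_
  · exact hp.injOn (Multiset.mem_range.1 hx) (Multiset.mem_range.1 hy)
  · simpa using Set.ext_iff.1 hp.image_eq a

theorem isCentered (h : IsGreedyTree α A G) : G.IsCentered := by
  obtain ⟨-, p, T, -, -, rfl⟩ := h
  exact BallTree.isCentered_build p T _

theorem exists_isSpread (hα : 1 < α) (h : IsGreedyTree α A G) :
    ∃ p : ℕ → X, G.center = p 0 ∧ G.IsSpread p (α ^ 3 / (α - 1)) := by
  obtain ⟨hA, p, T, hp, hT, rfl⟩ := h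
  have hpos := hA.card_pos
  exact ⟨p, BallTree.center_build p T _,
    (BallTree.isTraced_build hα hp hT (by lia)).isSpread hα⟩

end IsGreedyTree

/-! ### Effect and cost of the parts of the program -/

namespace Vertex

variable {X : Type u} [MetricSpace X]

/-- The distance between the centers of two nodes. -/
noncomputable def ctrDist (x y : Vertex X) : ℝ := dist x.tree.center y.tree.center

/-- The lower bound that the center and the radius of `y` give for the distances between the center
of `x` and the points below `y`. -/
noncomputable def lowerDist (x y : Vertex X) : ℝ := x.ctrDist y - y.tree.radius

end Vertex

namespace Memory

variable {X : Type u}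

/-- The adjacency lists describe a simple graph. -/
structure IsGraph (M : Memory X) : Prop where
  nodup : ∀ v, (M.adj v).Nodup
  symm : ∀ {v w}, w ∈ M.adj v → v ∈ M.adj w
  irrefl : ∀ v, v ∉ M.adj v

/-- All degrees are at most `D`. -/
def DegreeLE (D : ℕ) (M : Memory X) : Prop := ∀ v, (M.adj v).length ≤ D

open Classical in
/-- Overwrite the adjacency list of `v`. -/
noncomputable def write (v : Vertex X) (l : List (Vertex X)) (M : Memory X) : Memory X :=
  { M with adj := Function.update M.adj v l }

open Classical in
/-- Apply `f` to the adjacency lists of the listed nodes. -/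
noncomputable def modify (f : List (Vertex X) → List (Vertex X)) (vs : List (Vertex X))
    (M : Memory X) : Memory X :=
  { M with adj := fun v => if v ∈ vs then f (M.adj v) else M.adj v }

theorem modify_nil (f : List (Vertex X) → List (Vertex X)) (M : Memory X) :
    M.modify f [] = M := by
  simp [modify]

theorem modify_cons {f : List (Vertex X) → List (Vertex X)} {v : Vertex X}
    {vs : List (Vertex X)} (hv : v ∉ vs) (M : Memory X) :
    M.modify f (v :: vs) = (M.write v (f (M.adj v))).modify f vs := by
  classical
  simp only [modify, write, mk.injEq, and_true]
  funext w
  by_cases hw : w = v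
  · subst hw
    simp [hv]
  · simp only [List.mem_cons, hw, false_or, Function.update_of_ne hw]

open Classical in
/-- Replace `z` by `zl` and `zr`, both joined to all neighbours of `z`. -/
noncomputable def split (z zl zr : Vertex X) (M : Memory X) : Memory X :=
  (((M.write zl (M.adj z)).write zr (M.adj z)).modify
    (fun ws => zl :: zr :: ws.filter (· ≠ z)) (M.adj z)).write z []

theorem DegreeLE.write {D : ℕ} {M : Memory X} (hM : M.DegreeLE D) (v : Vertex X)
    {l : List (Vertex X)} (hl : l.length ≤ D) : (M.write v l).DegreeLE D := by
  intro w
  by_cases hw : w = v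
  · subst hw
    simpa [Memory.write] using hl
  · simpa [Memory.write, hw] using hM w

variable [MetricSpace X]

/-- The threshold above which the neighbours of `x` are removed. -/
noncomputable def pruneThreshold (x : Vertex X) (M : Memory X) : ℝ :=
  sInf (x.ctrDist '' {y | y ∈ M.adj x}) + 2 * x.tree.radius

open Classical in
/-- Remove the edges between `x` and the nodes whose `lowerDist` from `x` exceeds the threshold. -/
noncomputable def pruneAt (x : Vertex X) (M : Memory X) : Memory X :=
  { M with adj := fun v => (M.adj v).filter fun w =>
      (v = x → x.lowerDist w ≤ M.pruneThreshold x) ∧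
      (w = x → x.lowerDist v ≤ M.pruneThreshold x) }

/-- The local lower bound `ℓ(x)`; since `sInf ∅ = 0`, it is `0` for an isolated node. -/
noncomputable def localBound (x : Vertex X) (M : Memory X) : ℝ :=
  max (sInf (x.lowerDist '' {y | y ∈ M.adj x})) 0

open Classical in
/-- Record the local lower bound of `x`. -/
noncomputable def updateAt (x : Vertex X) (M : Memory X) : Memory X :=
  { M with
    low := Function.update M.low x (M.localBound x)
    best := max M.best (M.localBound x) }

/-- Prune `x`, then record its local lower bound. -/
noncomputable def refine (M : Memory X) (x : Vertex X) : Memory X := (M.pruneAt x).updateAt x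

theorem mem_adj_pruneAt {M : Memory X} {x v w : Vertex X} :
    w ∈ (M.pruneAt x).adj v ↔ w ∈ M.adj v ∧ (v = x → x.lowerDist w ≤ M.pruneThreshold x) ∧
      (w = x → x.lowerDist v ≤ M.pruneThreshold x) := by
  simp [pruneAt]

theorem IsGraph.pruneAt {M : Memory X} (hM : M.IsGraph) (x : Vertex X) :
    (M.pruneAt x).IsGraph where
  nodup v := (hM.nodup v).filter _
  symm h := by
    rw [mem_adj_pruneAt] at h ⊢
    exact ⟨hM.symm h.1, h.2.2, h.2.1⟩
  irrefl v h := hM.irrefl v (mem_adj_pruneAt.1 h).1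

theorem IsGraph.refine {M : Memory X} (hM : M.IsGraph) (x : Vertex X) : (M.refine x).IsGraph :=
  ⟨(hM.pruneAt x).nodup, (hM.pruneAt x).symm, (hM.pruneAt x).irrefl⟩

theorem DegreeLE.refine {D : ℕ} {M : Memory X} (hM : M.DegreeLE D) (x : Vertex X) :
    (M.refine x).DegreeLE D :=
  fun v => (List.length_filter_le _ _).trans (hM v)

open Classical in
theorem IsGraph.pruneAt_eq_write_modify {M : Memory X} (hM : M.IsGraph) (x : Vertex X) :
    M.pruneAt x = (M.modify (fun xs => xs.filter (· ≠ x))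
      ((M.adj x).filter (M.pruneThreshold x < x.lowerDist ·))).write x
      ((M.adj x).filter (x.lowerDist · ≤ M.pruneThreshold x)) := by
  simp only [Memory.pruneAt, write, modify, mk.injEq, and_true]
  funext v
  rcases eq_or_ne v x with rfl | hv
  · rw [Function.update_self]
    refine List.filter_congr fun w hw => ?_
    have : w ≠ v := fun h => hM.irrefl v (h ▸ hw)
    simp [this]
  rw [Function.update_of_ne hv]
  split_ifs with hmem
  · have hfar := of_decide_eq_true (List.mem_filter.1 hmem).2
    refine List.filter_congr fun w _ => ?_
    simp [hv, hfar]
  · refine List.filter_eq_self.2 fun w hw => ?_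
    refine decide_eq_true ⟨fun h => absurd h hv, ?_⟩
    rintro rfl
    by_contra! hfar
    exact hmem (List.mem_filter.2 ⟨hM.symm hw, decide_eq_true hfar⟩)

end Memory

namespace Hausdorff

variable {X : Type u}

theorem setAdj_eq (v : Vertex X) (l : List (Vertex X)) (M : Memory X) :
    setAdj v l M = ((), M.write v l, 1) := rfl

theorem minOver_eq {f : Vertex X → Comp X ℝ} {g : Vertex X → ℝ} {k : ℕ} {M : Memory X}
    (hf : ∀ v, f v M = (g v, M, k)) (l : List (Vertex X)) :
    ∃ c ≤ (k + 2) * l.length + 1, minOver f l M = (sInf (g '' {v | v ∈ l}), M, c) := by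
  induction l with
  | nil => exact ⟨1, by simp, by simp [minOver, Comp.bind, tick, Comp.query, Comp.instr, Comp.ret]⟩
  | cons v vs ih =>
    cases vs with
    | nil =>
      refine ⟨1 + k, by simp; lia, ?_⟩
      simp [minOver, Comp.bind, tick, Comp.query, Comp.instr, hf]
    | cons v' vs =>
      obtain ⟨c, hc, hmin⟩ := ih
      refine ⟨1 + (k + (c + 1)), by rw [List.length_cons]; linarith, ?_⟩
      have hinf : sInf (g '' {y | y ∈ v :: v' :: vs}) =
          min (g v) (sInf (g '' {y | y ∈ v' :: vs})) := by
        have hset : {y | y ∈ v :: v' :: vs} = insert v {y | y ∈ v' :: vs} :=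
          Set.ext fun y => List.mem_cons
        rw [hset, Set.image_insert_eq]
        exact csInf_insert ((List.finite_toSet _).image g).bddBelow ⟨g v', v', by simp, rfl⟩
      rw [hinf]
      simp only [minOver, Comp.bind, tick, Comp.query, Comp.instr, hf, hmin, minimum]

open Classical in
theorem deleteFrom_eq (x : Vertex X) (l : List (Vertex X)) (M : Memory X) :
    ∃ c ≤ 3 * l.length + 1, deleteFrom x l M = (l.filter (· ≠ x), M, c) := by
  induction l with
  | nil => exact ⟨1, by simp, rfl⟩
  | cons v vs ih =>
    obtain ⟨c, hc, hdel⟩ := ih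
    by_cases h : v = x
    · refine ⟨1 + (1 + c), by simp; lia, ?_⟩
      simp [deleteFrom, Comp.bind, tick, same, Comp.query, Comp.instr, h, hdel]
    · refine ⟨1 + (1 + (c + 1)), by simp; lia, ?_⟩
      simp [deleteFrom, Comp.bind, tick, same, prepend, Comp.query, Comp.instr, h, hdel]

open Classical in
theorem forEach_replaceIn_eq (z zl zr : Vertex X) {D : ℕ} {vs : List (Vertex X)}
    (hvs : vs.Nodup) (M : Memory X) (hD : ∀ v ∈ vs, (M.adj v).length ≤ D) :
    ∃ c ≤ (3 * D + 6) * vs.length + 1, forEach (replaceIn z zl zr) vs M =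
      ((), M.modify (fun ws => zl :: zr :: ws.filter (· ≠ z)) vs, c) := by
  induction vs generalizing M with
  | nil => exact ⟨1, by simp, by rw [Memory.modify_nil]; rfl⟩
  | cons v vs ih =>
    obtain ⟨hv, hvs⟩ := List.nodup_cons.1 hvs
    obtain ⟨c₁, hc₁, hdel⟩ := deleteFrom_eq z (M.adj v) M
    have hD' : ∀ w ∈ vs, ((M.write v (zl :: zr :: (M.adj v).filter (· ≠ z))).adj w).length ≤ D :=
      fun w hw => by
        have : w ≠ v := fun h => hv (h ▸ hw)
        simpa [Memory.write, this] using hD w (List.mem_cons_of_mem _ hw)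
    obtain ⟨c₂, hc₂, hrest⟩ := ih hvs _ hD'
    refine ⟨1 + (1 + (c₁ + 3) + c₂), ?_, ?_⟩
    · have := hD v List.mem_cons_self
      rw [List.length_cons]
      linarith
    · rw [Memory.modify_cons hv]
      simp only [forEach, replaceIn, Comp.bind, Comp.query, Comp.instr, tick, getAdj, hdel,
        prepend, setAdj_eq, hrest]

theorem splitVertex_eq {z zl zr : Vertex X} {D : ℕ} {M : Memory X} (hM : M.DegreeLE D)
    (hz : (M.adj z).Nodup) :
    ∃ c ≤ (3 * D + 6) * D + 5, splitVertex z zl zr M = (M.adj z, M.split z zl zr, c) := by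
  have hD : ((M.write zl (M.adj z)).write zr (M.adj z)).DegreeLE D :=
    (hM.write zl (hM z)).write zr (hM z)
  obtain ⟨c, hc, hloop⟩ := forEach_replaceIn_eq z zl zr hz _ fun v _ => hD v
  refine ⟨1 + (1 + (1 + (c + 1))), ?_, ?_⟩
  · have : (3 * D + 6) * (M.adj z).length ≤ (3 * D + 6) * D := by gcongr; exact hM z
    lia
  · simp only [splitVertex, Comp.bind, Comp.instr, getAdj, setAdj_eq, Comp.ret, hloop]
    rfl

variable [MetricSpace X]

theorem centerDist_eq (x y : Vertex X) (M : Memory X) : centerDist x y M = (x.ctrDist y, M, 3) :=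
  rfl

theorem gap_eq (x y : Vertex X) (M : Memory X) : gap x y M = (x.lowerDist y, M, 5) := rfl

theorem updateLow_eq (x : Vertex X) (M : Memory X) :
    ∃ c ≤ 7 * (M.adj x).length + 7, updateLow x M = ((), M.updateAt x, c) := by
  obtain ⟨c, hc, hmin⟩ := minOver_eq (fun v => gap_eq x v M) (M.adj x)
  refine ⟨1 + (c + 5), by lia, ?_⟩
  simp [updateLow, Comp.bind, getAdj, Comp.query, Comp.instr, maximum, setLow, getBest, setBest,
    hmin, Memory.updateAt, Memory.localBound]

open Classical in
theorem pruneAbove_eq (x : Vertex X) (t : ℝ) {D : ℕ} {l : List (Vertex X)} (hl : l.Nodup)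
    {M : Memory X} (hM : M.DegreeLE D) :
    ∃ c ≤ (3 * D + 10) * l.length + 1, pruneAbove x t l M =
      (l.filter (x.lowerDist · ≤ t),
        M.modify (fun xs => xs.filter (· ≠ x)) (l.filter (t < x.lowerDist ·)), c) := by
  induction l generalizing M with
  | nil => exact ⟨1, by simp, by simp only [List.filter_nil, Memory.modify_nil]; rfl⟩
  | cons y ys ih =>
    obtain ⟨hy, hys⟩ := List.nodup_cons.1 hl
    by_cases h : t < x.lowerDist y
    · obtain ⟨c₁, hc₁, hdel⟩ := deleteFrom_eq x (M.adj y) M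
      obtain ⟨c₂, hc₂, hrest⟩ := ih hys
        (hM.write y ((List.length_filter_le (· ≠ x) _).trans (hM y)))
      refine ⟨1 + (5 + (1 + (1 + (c₁ + (1 + c₂))))), ?_, ?_⟩
      · have := hM y
        rw [List.length_cons]
        linarith
      · rw [List.filter_cons_of_neg (by simpa using h), List.filter_cons_of_pos (by simpa using h),
          Memory.modify_cons fun hmem => hy (List.mem_filter.1 hmem).1]
        simp only [pruneAbove, Comp.bind, tick, Comp.query, Comp.instr, gap_eq, lessThan,
          decide_eq_true_eq, h, ↓reduceIte, getAdj, hdel, setAdj_eq, hrest]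
    · obtain ⟨c, hc, hrest⟩ := ih hys hM
      refine ⟨1 + (5 + (1 + (c + 1))), by rw [List.length_cons]; linarith, ?_⟩
      rw [List.filter_cons_of_pos (by simpa using h), List.filter_cons_of_neg (by simpa using h)]
      simp [pruneAbove, Comp.bind, tick, Comp.query, Comp.instr, gap_eq, lessThan, h, hrest,
        prepend]

theorem prune_eq (x : Vertex X) {D : ℕ} {M : Memory X} (hM : M.IsGraph) (hD : M.DegreeLE D) :
    ∃ c ≤ (3 * D + 15) * D + 7, prune x M = ((), M.pruneAt x, c) := by
  obtain ⟨c₁, hc₁, hmin⟩ := minOver_eq (fun v => centerDist_eq x v M) (M.adj x)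
  obtain ⟨c₂, hc₂, hprune⟩ := pruneAbove_eq x (M.pruneThreshold x) (hM.nodup x) hD
  refine ⟨1 + (c₁ + (1 + (1 + (1 + (c₂ + 1))))), ?_, ?_⟩
  · have : (3 * D + 15) * (M.adj x).length ≤ (3 * D + 15) * D := by gcongr; exact hD x
    lia
  · simp only [prune, Comp.bind, Comp.query, Comp.instr, hmin, getAdj, getRadius, add, setAdj_eq,
      ← two_mul]
    rw [← Memory.pruneThreshold, hprune, hM.pruneAt_eq_write_modify]

theorem forEach_refine_eq {D : ℕ} (S : List (Vertex X)) {M : Memory X} (hM : M.IsGraph)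
    (hD : M.DegreeLE D) :
    ∃ c ≤ ((3 * D + 22) * D + 15) * S.length + 1,
      forEach (fun x => prune x ≫= fun _ => updateLow x) S M =
        ((), S.foldl Memory.refine M, c) := by
  induction S generalizing M with
  | nil => exact ⟨1, by simp, rfl⟩
  | cons x S ih =>
    obtain ⟨c₁, hc₁, hprune⟩ := prune_eq x hM hD
    obtain ⟨c₂, hc₂, hupdate⟩ := updateLow_eq x (M.pruneAt x)
    obtain ⟨c₃, hc₃, hrest⟩ := ih (hM.refine x) (hD.refine x)
    refine ⟨1 + (c₁ + c₂ + c₃), ?_, ?_⟩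
    · have : ((M.pruneAt x).adj x).length ≤ D := hD.refine x x
      rw [List.length_cons]
      linarith
    · simp only [forEach, tick, Comp.bind, Comp.query, Comp.instr, hprune, hupdate]
      rw [← Memory.refine, hrest]
      rfl

end Hausdorff

/-! ### The heap of the traversal -/

/-- The copy of `X` in `X ⊕ X` that holds the points of the given side. -/
def Side.inject {X : Type u} : Side → X → X ⊕ X
  | .inA => Sum.inl
  | .inB => Sum.inr

theorem Side.inject_inj {X : Type u} {s t : Side} {x y : X} :
    s.inject x = t.inject y ↔ s = t ∧ x = y := by
  cases s <;> cases t <;> simp [inject]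

theorem Side.ne_inA_iff {s : Side} : s ≠ .inA ↔ s = .inB := by cases s <;> simp

namespace Vertex

variable {X : Type u}

/-- The points below a node, labelled by the side of the node. -/
def points (v : Vertex X) : Multiset (X ⊕ X) := v.tree.leaves.map v.side.inject

theorem mem_points {v : Vertex X} {s : Side} {x : X} :
    s.inject x ∈ v.points ↔ v.side = s ∧ x ∈ v.tree.leaves := by
  simp only [points, Multiset.mem_map, Side.inject_inj]
  aesop

/-- `zl` and `zr` are two nodes on the side of `z` that share the points below `z`. -/
structure IsSplit (z zl zr : Vertex X) : Prop where
  side_left : zl.side = z.side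
  side_right : zr.side = z.side
  leaves_eq : z.tree.leaves = zl.tree.leaves + zr.tree.leaves

theorem isSplit_node (s : Side) (c : X) (l r : BallTree X) :
    IsSplit ⟨s, .node c l r⟩ ⟨s, l⟩ ⟨s, r⟩ := ⟨rfl, rfl, rfl⟩

namespace IsSplit

variable {z zl zr : Vertex X}

theorem left_ne (h : IsSplit z zl zr) : zl ≠ z := by
  rintro rfl
  have := congrArg Multiset.card h.leaves_eq
  have := zr.tree.card_leaves_pos
  rw [Multiset.card_add] at *
  lia

theorem right_ne (h : IsSplit z zl zr) : zr ≠ z := by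
  rintro rfl
  have := congrArg Multiset.card h.leaves_eq
  have := zl.tree.card_leaves_pos
  rw [Multiset.card_add] at *
  lia

theorem points_eq (h : IsSplit z zl zr) : z.points = zl.points + zr.points := by
  rw [points, points, points, h.side_left, h.side_right, h.leaves_eq, Multiset.map_add]

end IsSplit

end Vertex

theorem RadiusOrder.length_add_card_le {X : Type u} [MetricSpace X] {H : Multiset (Vertex X)}
    {zs : List (Vertex X)} (h : RadiusOrder H zs) :
    zs.length + H.card ≤ (H.bind Vertex.points).card := by
  induction h with
  | done H _ =>
    have hpos : ∀ k ∈ H.map (Multiset.card ∘ Vertex.points), 1 ≤ k :=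
      Multiset.forall_mem_map_iff.2 fun v _ =>
        (Nat.succ_le_of_lt v.tree.card_leaves_pos).trans_eq (Multiset.card_map ..).symm
    simpa [Multiset.card_bind] using Multiset.card_nsmul_le_sum hpos
  | pop H s c l r zs _ _ _ ih =>
    simp only [Multiset.cons_bind, Multiset.card_add, Multiset.card_cons, List.length_cons,
      (Vertex.isSplit_node s c l r).points_eq] at ih ⊢
    lia

/-- The nodes of the heap partition `A` and `B`. -/
structure Decomposes {X : Type u} (A B : Finset X) (H : Multiset (Vertex X)) : Prop where
  points : H.bind Vertex.points = (A.disjSum B).val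
  isCentered : ∀ v ∈ H, v.tree.IsCentered

namespace Decomposes

variable {X : Type u} {A B : Finset X} {H : Multiset (Vertex X)}

theorem center_mem_leaves (h : Decomposes A B H) {v : Vertex X} (hv : v ∈ H) :
    v.tree.center ∈ v.tree.leaves := (h.isCentered v hv).center_mem_leaves

theorem eq_of_mem_leaves (h : Decomposes A B H) {v w : Vertex X} (hv : v ∈ H) (hw : w ∈ H)
    (hs : v.side = w.side) {x : X} (hxv : x ∈ v.tree.leaves) (hxw : x ∈ w.tree.leaves) :
    v = w := by
  have hnodup : (H.bind Vertex.points).Nodup := h.points ▸ (A.disjSum B).nodup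
  by_contra hne
  have : Std.Symm (Function.onFun (Disjoint (α := Multiset (X ⊕ X))) Vertex.points) :=
    ⟨fun _ _ hd => hd.symm⟩
  have hdisj : Disjoint v.points w.points :=
    (Multiset.nodup_bind.1 hnodup).2.forall hv hw hne
  exact Multiset.disjoint_left.1 hdisj (Vertex.mem_points.2 ⟨rfl, hxv⟩)
    (Vertex.mem_points.2 ⟨hs.symm, hxw⟩)

theorem nodup (h : Decomposes A B H) : H.Nodup := by
  have hnodup : (H.bind Vertex.points).Nodup := h.points ▸ (A.disjSum B).nodup
  rw [Multiset.nodup_iff_ne_cons_cons]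
  rintro v t rfl
  have hdisj : Disjoint v.points (v.points + t.bind Vertex.points) := by
    rw [Multiset.cons_bind, Multiset.cons_bind, Multiset.nodup_add] at hnodup
    exact hnodup.2.2
  have hcenter := Vertex.mem_points.2 ⟨rfl, h.center_mem_leaves (Multiset.mem_cons_self v _)⟩
  exact Multiset.disjoint_left.1 hdisj hcenter (Multiset.mem_add.2 (.inl hcenter))

theorem exists_mem_leaves_iff (h : Decomposes A B H) {s : Side} {x : X} :
    (∃ v ∈ H, v.side = s ∧ x ∈ v.tree.leaves) ↔ s.inject x ∈ A.disjSum B := by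
  simp only [← Finset.mem_val, ← h.points, Multiset.mem_bind, Vertex.mem_points]

theorem exists_mem_leaves (h : Decomposes A B H) {a : X} (ha : a ∈ A) :
    ∃ v ∈ H, v.side = .inA ∧ a ∈ v.tree.leaves :=
  h.exists_mem_leaves_iff.2 (Finset.inl_mem_disjSum.2 ha)

theorem center_mem_left (h : Decomposes A B H) {v : Vertex X} (hv : v ∈ H)
    (hs : v.side = .inA) : v.tree.center ∈ A :=
  Finset.inl_mem_disjSum.1 (h.exists_mem_leaves_iff.1 ⟨v, hv, hs, h.center_mem_leaves hv⟩)

theorem center_mem_right (h : Decomposes A B H) {v : Vertex X} (hv : v ∈ H)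
    (hs : v.side = .inB) : v.tree.center ∈ B :=
  Finset.inr_mem_disjSum.1 (h.exists_mem_leaves_iff.1 ⟨v, hv, hs, h.center_mem_leaves hv⟩)

theorem pop {s : Side} {c : X} {l r : BallTree X}
    (h : Decomposes A B (⟨s, .node c l r⟩ ::ₘ H)) :
    Decomposes A B (⟨s, l⟩ ::ₘ ⟨s, r⟩ ::ₘ H) where
  points := by
    rw [← h.points]
    simp only [Multiset.cons_bind, (Vertex.isSplit_node s c l r).points_eq, add_assoc]
  isCentered v hv := by
    obtain ⟨⟨-, hl, hr⟩, hH⟩ := Multiset.forall_mem_cons.1 h.isCentered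
    rcases Multiset.mem_cons.1 hv with rfl | hv
    · exact hl
    rcases Multiset.mem_cons.1 hv with rfl | hv
    exacts [hr, hH v hv]

end Decomposes

theorem decomposes_roots {X : Type u} [MetricSpace X] {α : ℝ} {A B : Finset X}
    {GA GB : BallTree X} (hGA : IsGreedyTree α A GA) (hGB : IsGreedyTree α B GB) :
    Decomposes A B {⟨Side.inA, GA⟩, ⟨Side.inB, GB⟩} where
  points := by
    simp [Multiset.insert_eq_cons, Multiset.cons_bind, Vertex.points, Side.inject, hGA.leaves_eq,
      hGB.leaves_eq, Finset.val_disjSum, Multiset.disjSum]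
  isCentered := by simp [Multiset.insert_eq_cons, hGA.isCentered, hGB.isCentered]

/-- The heap at scale `ρ`: on each side the centers come from the sequence `p` and are at least `ρ`
apart, and the nodes have diameter at most `2 * κ * ρ`. Diameters are controlled instead of radii
because a child can have a larger radius than its parent. -/
structure IsSpaced {X : Type u} [MetricSpace X] (p : Side → ℕ → X) (κ ρ : ℝ)
    (H : Multiset (Vertex X)) : Prop where
  isSpread : ∀ v ∈ H, v.tree.IsSpread (p v.side) κ
  placed : ∀ v ∈ H, ∃ k, v.tree.center = p v.side k ∧
    (k = 0 ∨ ρ ≤ prefixDist (p v.side) k (p v.side k))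
  dist_le : ∀ v ∈ H, ∀ x ∈ v.tree.leaves, ∀ y ∈ v.tree.leaves, dist x y ≤ 2 * κ * ρ

namespace IsSpaced

variable {X : Type u} [MetricSpace X] {A B : Finset X} {p : Side → ℕ → X} {κ ρ : ℝ}
  {H : Multiset (Vertex X)}

theorem le_dist_center (h : IsSpaced p κ ρ H) (hH : Decomposes A B H) {v w : Vertex X}
    (hv : v ∈ H) (hw : w ∈ H) (hs : v.side = w.side) (hne : v ≠ w) :
    ρ ≤ dist v.tree.center w.tree.center := by
  obtain ⟨j, hj, hj'⟩ := h.placed v hv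
  obtain ⟨k, hk, hk'⟩ := h.placed w hw
  rw [← hs] at hk hk'
  rw [hj, hk]
  rcases lt_trichotomy j k with hjk | rfl | hkj
  · rw [dist_comm]
    exact (hk'.resolve_left (by lia)).trans
      (Metric.infDist_le_dist_of_mem (Set.mem_image_of_mem _ hjk))
  · have hcenter : v.tree.center = w.tree.center := hj.trans hk.symm
    exact absurd (hH.eq_of_mem_leaves hv hw hs (hH.center_mem_leaves hv)
      (hcenter ▸ hH.center_mem_leaves hw)) hne
  · exact (hj'.resolve_left (by lia)).trans
      (Metric.infDist_le_dist_of_mem (Set.mem_image_of_mem _ hkj))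

theorem radius_le (h : IsSpaced p κ ρ H) (hH : Decomposes A B H) {v : Vertex X} (hv : v ∈ H) :
    v.tree.radius ≤ 2 * κ * ρ := by
  obtain ⟨x, hx, hradius⟩ := v.tree.exists_maxDist_eq v.tree.center
  exact hradius.trans_le (h.dist_le v hv _ (hH.center_mem_leaves hv) _ hx)

theorem pop (hκ : 0 < κ) {s : Side} {c : X} {l r : BallTree X}
    (h : IsSpaced p κ ρ (⟨s, .node c l r⟩ ::ₘ H)) (hl : l.center = c)
    (hmax : ∀ v ∈ H, v.tree.radius ≤ (BallTree.node c l r).radius) :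
    IsSpaced p κ (min ρ ((BallTree.node c l r).radius / κ)) (⟨s, l⟩ ::ₘ ⟨s, r⟩ ::ₘ H) := by
  obtain ⟨⟨⟨i, hi, hradius⟩, hspreadl, hspreadr⟩, hspread⟩ := Multiset.forall_mem_cons.1 h.isSpread
  obtain ⟨⟨k, hk, hk'⟩, hplaced⟩ := Multiset.forall_mem_cons.1 h.placed
  obtain ⟨hz, hdist⟩ := Multiset.forall_mem_cons.1 h.dist_le
  have hscale : 2 * κ * min ρ ((BallTree.node c l r).radius / κ) =
      min (2 * κ * ρ) (2 * (BallTree.node c l r).radius) := by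
    rw [mul_min_of_nonneg _ _ (by positivity)]
    field_simp
  have hnode : ∀ x ∈ (BallTree.node c l r).leaves, ∀ y ∈ (BallTree.node c l r).leaves,
      dist x y ≤ 2 * κ * min ρ ((BallTree.node c l r).radius / κ) := fun x hx y hy =>
    hscale ▸ le_min (hz x hx y hy) (BallTree.dist_le_two_mul_radius hx hy)
  constructor
  · exact Multiset.forall_mem_cons.2 ⟨hspreadl, Multiset.forall_mem_cons.2 ⟨hspreadr, hspread⟩⟩
  · refine Multiset.forall_mem_cons.2 ⟨⟨k, hl.trans hk, hk'.imp_right (min_le_left _ _).trans⟩,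
      Multiset.forall_mem_cons.2 ⟨⟨i, hi, .inr ((min_le_right _ _).trans ?_)⟩, fun v hv => ?_⟩⟩
    · exact (div_le_iff₀' hκ).2 hradius
    · obtain ⟨j, hj, hj'⟩ := hplaced v hv
      exact ⟨j, hj, hj'.imp_right (min_le_left _ _).trans⟩
  · refine Multiset.forall_mem_cons.2 ⟨fun x hx y hy => ?_,
      Multiset.forall_mem_cons.2 ⟨fun x hx y hy => ?_, fun v hv x hx y hy => ?_⟩⟩
    · exact hnode x (Multiset.mem_add.2 (.inl hx)) y (Multiset.mem_add.2 (.inl hy))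
    · exact hnode x (Multiset.mem_add.2 (.inr hx)) y (Multiset.mem_add.2 (.inr hy))
    · refine hscale ▸ le_min (hdist v hv x hx y hy)
        ((BallTree.dist_le_two_mul_radius hx hy).trans ?_)
      gcongr
      exact hmax v hv

end IsSpaced

theorem exists_isSpaced_roots {X : Type u} [MetricSpace X] {α : ℝ} (hα : 1 < α) {A B : Finset X}
    {GA GB : BallTree X} (hGA : IsGreedyTree α A GA) (hGB : IsGreedyTree α B GB) :
    ∃ p ρ, IsSpaced p (α ^ 3 / (α - 1)) ρ {⟨Side.inA, GA⟩, ⟨Side.inB, GB⟩} := by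
  obtain ⟨pA, hcenterA, hspreadA⟩ := hGA.exists_isSpread hα
  obtain ⟨pB, hcenterB, hspreadB⟩ := hGB.exists_isSpread hα
  have hκ : 0 < α ^ 3 / (α - 1) := div_pos (by positivity) (by linarith)
  set κ := α ^ 3 / (α - 1)
  have hscale : 2 * κ * ((GA.radius + GB.radius) / κ) = 2 * GA.radius + 2 * GB.radius := by
    field_simp
  have hA := GA.radius_nonneg
  have hB := GB.radius_nonneg
  refine ⟨fun s => match s with | .inA => pA | .inB => pB, (GA.radius + GB.radius) / κ, ?_, ?_, ?_⟩
    <;> simp only [Multiset.insert_eq_cons, Multiset.mem_cons, Multiset.mem_singleton,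
      forall_eq_or_imp, forall_eq, hscale]
  · exact ⟨hspreadA, hspreadB⟩
  · exact ⟨⟨0, hcenterA, .inl rfl⟩, ⟨0, hcenterB, .inl rfl⟩⟩
  · exact ⟨fun x hx y hy => by linarith [BallTree.dist_le_two_mul_radius hx hy],
      fun x hx y hy => by linarith [BallTree.dist_le_two_mul_radius hx hy]⟩

/-! ### The invariant of the viability graph -/

namespace Memory

variable {X : Type u} {z zl zr : Vertex X} {M : Memory X}

/-- The nodes that the algorithm refines after it has split `z` into `zl` and `zr`. -/
def affected (z zl zr : Vertex X) (M : Memory X) : List (Vertex X) :=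
  match z.side with
  | .inA => [zl, zr]
  | .inB => M.adj z

open Classical in
theorem adj_split (hz : z ∉ M.adj z) (hl : zl ∉ M.adj z) (hr : zr ∉ M.adj z) (v : Vertex X) :
    (M.split z zl zr).adj v =
      if v = z then []
      else if v ∈ M.adj z then zl :: zr :: (M.adj v).filter (· ≠ z)
      else if v = zl ∨ v = zr then M.adj z
      else M.adj v := by
  rcases eq_or_ne v z with rfl | hvz
  · simp [split, write]
  by_cases hv : v ∈ M.adj z
  · have hvl : v ≠ zl := fun h => hl (h ▸ hv)
    have hvr : v ≠ zr := fun h => hr (h ▸ hv)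
    simp [split, write, modify, hvz, hv, hvl, hvr]
  · by_cases hvl : v = zl <;> by_cases hvr : v = zr <;>
      simp_all [split, write, modify]

theorem DegreeLE.split {D : ℕ} (hM : M.DegreeLE D) :
    (M.split z zl zr).DegreeLE (D + 2) := by
  have hD := (hM.write zl (hM z)).write zr (hM z)
  refine DegreeLE.write (fun v => ?_) z (Nat.zero_le _)
  simp only [modify]
  split_ifs
  · exact Nat.add_le_add_right ((List.length_filter_le _ _).trans (hD v)) 2
  · exact (hD v).trans (Nat.le_add_right _ _)

end Memory

namespace Vertex

variable {X : Type u} {z zl zr : Vertex X}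

open Classical in
/-- The node from which `v` stems when `z` has been split into `zl` and `zr`. -/
noncomputable def parent (z zl zr v : Vertex X) : Vertex X := if v = zl ∨ v = zr then z else v

theorem parent_left : parent z zl zr zl = z := if_pos (.inl rfl)

theorem parent_right : parent z zl zr zr = z := if_pos (.inr rfl)

theorem parent_of_ne {v : Vertex X} (hl : v ≠ zl) (hr : v ≠ zr) : parent z zl zr v = v :=
  if_neg (not_or.2 ⟨hl, hr⟩)

theorem IsSplit.side_parent (h : IsSplit z zl zr) (v : Vertex X) :
    (parent z zl zr v).side = v.side := by
  unfold parent
  split_ifs with hv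
  · rcases hv with rfl | rfl
    exacts [h.side_left.symm, h.side_right.symm]
  · rfl

theorem IsSplit.mem_leaves_parent (h : IsSplit z zl zr) {v : Vertex X} {x : X}
    (hx : x ∈ v.tree.leaves) : x ∈ (parent z zl zr v).tree.leaves := by
  unfold parent
  split_ifs with hv
  · rw [h.leaves_eq, Multiset.mem_add]
    rcases hv with rfl | rfl
    exacts [.inl hx, .inr hx]
  · exact hx

theorem parent_mem {H : Multiset (Vertex X)} {v : Vertex X} (hv : v ∈ zl ::ₘ zr ::ₘ H) :
    parent z zl zr v ∈ z ::ₘ H := by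
  unfold parent
  split_ifs with h
  · exact Multiset.mem_cons_self z H
  · exact Multiset.mem_cons_of_mem (by simpa [not_or.1 h] using hv)

end Vertex

theorem Memory.IsGraph.mem_adj_split {X : Type u} {z zl zr : Vertex X} {M : Memory X}
    (hM : M.IsGraph) (hl : ∀ v, zl ∉ M.adj v) (hr : ∀ v, zr ∉ M.adj v) {v w : Vertex X} :
    w ∈ (M.split z zl zr).adj v ↔
      v ≠ z ∧ w ≠ z ∧ Vertex.parent z zl zr w ∈ M.adj (Vertex.parent z zl zr v) := by
  rw [adj_split (hM.irrefl z) (hl z) (hr z)]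
  have hz : z ∈ M.adj v ↔ v ∈ M.adj z := ⟨hM.symm, hM.symm⟩
  have hirrefl := hM.irrefl z
  have hlz := hl z
  have hrz := hr z
  have hlv := hl v
  have hrv := hr v
  unfold Vertex.parent
  grind

/-- The edges join nodes of `H` on different sides. -/
structure IsBipartite {X : Type u} (H : Multiset (Vertex X)) (M : Memory X) : Prop where
  mem : ∀ {v w}, w ∈ M.adj v → w ∈ H
  symm : ∀ {v w}, w ∈ M.adj v → v ∈ M.adj w
  side_ne : ∀ {v w}, w ∈ M.adj v → v.side ≠ w.side
  nodup : ∀ v, (M.adj v).Nodup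

namespace IsBipartite

variable {X : Type u} {H : Multiset (Vertex X)} {M : Memory X}

theorem isGraph (h : IsBipartite H M) : M.IsGraph :=
  ⟨h.nodup, h.symm, fun _ hv => h.side_ne hv rfl⟩

theorem side_eq_inB (h : IsBipartite H M) {x y : Vertex X} (hx : x.side = .inA)
    (hy : y ∈ M.adj x) : y.side = .inB :=
  Side.ne_inA_iff.1 (hx ▸ (h.side_ne hy).symm)

theorem side_eq_inA (h : IsBipartite H M) {x y : Vertex X} (hx : x.side = .inB)
    (hy : y ∈ M.adj x) : y.side = .inA := by
  by_contra hA
  exact h.side_ne hy (hx.trans (Side.ne_inA_iff.1 hA).symm)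

theorem pruneAt [MetricSpace X] (h : IsBipartite H M) (x : Vertex X) :
    IsBipartite H (M.pruneAt x) where
  mem hw := h.mem (Memory.mem_adj_pruneAt.1 hw).1
  symm := (h.isGraph.pruneAt x).symm
  side_ne hw := h.side_ne (Memory.mem_adj_pruneAt.1 hw).1
  nodup := (h.isGraph.pruneAt x).nodup

variable {z zl zr : Vertex X}

theorem left_notMem_adj (h : IsBipartite (z ::ₘ H) M) (hs : z.IsSplit zl zr)
    (hH : (zl ::ₘ zr ::ₘ H).Nodup) (v : Vertex X) : zl ∉ M.adj v := fun hv =>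
  (Multiset.nodup_cons.1 hH).1
    (Multiset.mem_cons_of_mem ((Multiset.mem_cons.1 (h.mem hv)).resolve_left hs.left_ne))

theorem right_notMem_adj (h : IsBipartite (z ::ₘ H) M) (hs : z.IsSplit zl zr)
    (hH : (zl ::ₘ zr ::ₘ H).Nodup) (v : Vertex X) : zr ∉ M.adj v := fun hv =>
  (Multiset.nodup_cons.1 (Multiset.nodup_cons.1 hH).2).1
    ((Multiset.mem_cons.1 (h.mem hv)).resolve_left hs.right_ne)

theorem mem_adj_split (h : IsBipartite (z ::ₘ H) M) (hs : z.IsSplit zl zr)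
    (hH : (zl ::ₘ zr ::ₘ H).Nodup) {v w : Vertex X} :
    w ∈ (M.split z zl zr).adj v ↔
      v ≠ z ∧ w ≠ z ∧ Vertex.parent z zl zr w ∈ M.adj (Vertex.parent z zl zr v) :=
  h.isGraph.mem_adj_split (h.left_notMem_adj hs hH) (h.right_notMem_adj hs hH)

theorem nodup_adj_split (h : IsBipartite (z ::ₘ H) M) (hs : z.IsSplit zl zr)
    (hH : (zl ::ₘ zr ::ₘ H).Nodup) (v : Vertex X) : ((M.split z zl zr).adj v).Nodup := by
  have hl := h.left_notMem_adj hs hH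
  have hr := h.right_notMem_adj hs hH
  have hne : zl ≠ zr := by
    rintro rfl
    simp at hH
  rw [Memory.adj_split (h.isGraph.irrefl z) (hl z) (hr z)]
  split_ifs
  · exact List.nodup_nil
  · simp [hne, hl v, hr v, (h.nodup v).filter]
  · exact h.nodup z
  · exact h.nodup v

theorem split (h : IsBipartite (z ::ₘ H) M) (hs : z.IsSplit zl zr)
    (hH : (zl ::ₘ zr ::ₘ H).Nodup) : IsBipartite (zl ::ₘ zr ::ₘ H) (M.split z zl zr) where
  mem {v w} hw := by
    obtain ⟨-, hwz, hadj⟩ := (h.mem_adj_split hs hH).1 hw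
    have hmem := h.mem hadj
    by_cases hl : w = zl
    · simp [hl]
    by_cases hr : w = zr
    · simp [hr]
    rw [Vertex.parent_of_ne hl hr, Multiset.mem_cons] at hmem
    simp [hmem.resolve_left hwz]
  symm {v w} hw := by
    rw [h.mem_adj_split hs hH] at hw ⊢
    exact ⟨hw.2.1, hw.1, h.symm hw.2.2⟩
  side_ne {v w} hw := by
    have hne := h.side_ne ((h.mem_adj_split hs hH).1 hw).2.2
    rwa [hs.side_parent, hs.side_parent] at hne
  nodup := h.nodup_adj_split hs hH

theorem notMem_of_notMem_affected (h : IsBipartite (z ::ₘ H) M) (hs : z.IsSplit zl zr)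
    {x : Vertex X} (hx : x.side = .inA) (hS : x ∉ M.affected z zl zr) :
    x ∉ M.adj z ∧ x ≠ zl ∧ x ≠ zr := by
  unfold Memory.affected at hS
  cases hz : z.side with
  | inA =>
    rw [hz] at hS
    exact ⟨fun hadj => h.side_ne hadj (hz.trans hx.symm), by simpa using hS⟩
  | inB =>
    rw [hz] at hS
    refine ⟨hS, ?_, ?_⟩
    · rintro rfl
      simp [← hs.side_left, hx] at hz
    · rintro rfl
      simp [← hs.side_right, hx] at hz

theorem mem_of_mem_affected (h : IsBipartite (z ::ₘ H) M) (hs : z.IsSplit zl zr) {x : Vertex X}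
    (hx : x ∈ M.affected z zl zr) : x ∈ zl ::ₘ zr ::ₘ H ∧ x.side = .inA := by
  unfold Memory.affected at hx
  cases hz : z.side with
  | inA =>
    rw [hz] at hx
    rcases List.mem_pair.1 hx with rfl | rfl
    · exact ⟨by simp, hs.side_left.trans hz⟩
    · exact ⟨by simp, hs.side_right.trans hz⟩
  | inB =>
    rw [hz] at hx
    have hxz : x ≠ z := fun e => h.side_ne hx (by rw [e])
    exact ⟨by simp [(Multiset.mem_cons.1 (h.mem hx)).resolve_left hxz], h.side_eq_inA hz hx⟩

end IsBipartite

section Bounds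

variable {X : Type u} [MetricSpace X] {M : Memory X} {x y : Vertex X}

theorem Vertex.lowerDist_le_dist {b : X} (hb : b ∈ y.tree.leaves) :
    x.lowerDist y ≤ dist x.tree.center b := by
  have hradius := BallTree.dist_center_le_radius hb
  have htri := dist_triangle_right x.tree.center y.tree.center b
  unfold Vertex.lowerDist Vertex.ctrDist
  linarith

namespace Memory

theorem pruneThreshold_le (hy : y ∈ M.adj x) :
    M.pruneThreshold x ≤ x.ctrDist y + 2 * x.tree.radius := by
  unfold pruneThreshold
  gcongr
  exact csInf_le ((List.finite_toSet _).image _).bddBelow (Set.mem_image_of_mem _ hy)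

theorem exists_pruneThreshold_eq (hy : y ∈ M.adj x) :
    ∃ y' ∈ M.adj x, M.pruneThreshold x = x.ctrDist y' + 2 * x.tree.radius := by
  obtain ⟨y', hy', hmin⟩ := Set.Nonempty.csInf_mem (Set.Nonempty.image x.ctrDist ⟨y, hy⟩)
    ((List.finite_toSet (M.adj x)).image _)
  exact ⟨y', hy', by rw [pruneThreshold, ← hmin]⟩

theorem localBound_le (hy : y ∈ M.adj x) : M.localBound x ≤ max (x.lowerDist y) 0 :=
  max_le_max_right 0
    (csInf_le ((List.finite_toSet _).image _).bddBelow (Set.mem_image_of_mem _ hy))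

theorem exists_lowerDist_le_localBound (hy : y ∈ M.adj x) :
    ∃ y' ∈ M.adj x, x.lowerDist y' ≤ M.localBound x := by
  obtain ⟨y', hy', hmin⟩ := Set.Nonempty.csInf_mem (Set.Nonempty.image x.lowerDist ⟨y, hy⟩)
    ((List.finite_toSet (M.adj x)).image _)
  exact ⟨y', hy', hmin.le.trans (le_max_left _ _)⟩

/-- Pruning `x` removes no edge. -/
def IsPruned (x : Vertex X) (M : Memory X) : Prop :=
  ∀ y ∈ M.adj x, ∀ y' ∈ M.adj x, x.lowerDist y ≤ x.ctrDist y' + 2 * x.tree.radius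

theorem isPruned_pruneAt (x : Vertex X) (M : Memory X) : (M.pruneAt x).IsPruned x := by
  intro y hy y' hy'
  rw [mem_adj_pruneAt] at hy hy'
  exact (hy.2.1 rfl).trans (pruneThreshold_le hy'.1)

end Memory

end Bounds

/-- The invariant of the viability graph, for the heap `H`: every point of `A` is below a node whose
neighbours contain the nearest points of `B`, and the nodes on the side of `A` outside the list
`pending` are pruned and accounted for in the lower bound `best`. -/
structure IsViable {X : Type u} [MetricSpace X] (A B : Finset X) (H : Multiset (Vertex X))
    (pending : List (Vertex X)) (M : Memory X) : Prop extends IsBipartite H M where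
  cover : ∀ x ∈ H, x.side = .inA → ∀ a ∈ x.tree.leaves, ∀ b ∈ B, (∀ b' ∈ B, dist a b ≤ dist a b') →
    ∃ y ∈ M.adj x, b ∈ y.tree.leaves
  isPruned : ∀ x ∈ H, x.side = .inA → x ∉ pending → M.IsPruned x
  low : ∀ x ∈ H, x.side = .inA → x ∉ pending → ∃ y ∈ M.adj x, x.lowerDist y ≤ M.best
  best_nonneg : 0 ≤ M.best
  best_le : ∃ a ∈ A, ∀ b ∈ B, M.best ≤ dist a b

namespace IsViable

variable {X : Type u} [MetricSpace X] {A B : Finset X} {H : Multiset (Vertex X)}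
  {pending : List (Vertex X)} {M : Memory X} {x : Vertex X}

theorem mem_adj_pruneAt (h : IsViable A B H pending M) {v w : Vertex X} (hx : x.side = .inA)
    (hv : v.side = .inA) :
    w ∈ (M.pruneAt x).adj v ↔ w ∈ M.adj v ∧ (v = x → x.lowerDist w ≤ M.pruneThreshold x) := by
  rw [Memory.mem_adj_pruneAt]
  refine ⟨fun hw => ⟨hw.1, hw.2.1⟩, fun hw => ⟨hw.1, hw.2, ?_⟩⟩
  rintro rfl
  exact absurd (hv.trans hx.symm) (h.side_ne hw.1)

/-- If `b` is nearest to the point `a` below `x`, then the node `y` above `b` survives: for every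
neighbour `y'` of `x`, `lowerDist x y ≤ d(x, b) ≤ rad x + d(a, b) ≤ rad x + d(a, y')`. -/
theorem lowerDist_le_pruneThreshold (h : IsViable A B H pending M) (hH : Decomposes A B H)
    (hx : x.side = .inA) {a b : X} (ha : a ∈ x.tree.leaves) (hmin : ∀ b' ∈ B, dist a b ≤ dist a b')
    {y : Vertex X} (hy : y ∈ M.adj x) (hb : b ∈ y.tree.leaves) :
    x.lowerDist y ≤ M.pruneThreshold x := by
  obtain ⟨y', hy', hthreshold⟩ := Memory.exists_pruneThreshold_eq hy
  have hnear := hmin _ (hH.center_mem_right (h.mem hy') (h.side_eq_inB hx hy'))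
  have hradius := BallTree.dist_center_le_radius ha
  rw [hthreshold]
  calc x.lowerDist y ≤ dist x.tree.center b := Vertex.lowerDist_le_dist hb
    _ ≤ dist x.tree.center a + dist a b := dist_triangle _ _ _
    _ ≤ dist x.tree.center a + (dist x.tree.center a + x.ctrDist y') := by
        gcongr
        exact hnear.trans (dist_triangle_left _ _ _)
    _ ≤ x.ctrDist y' + 2 * x.tree.radius := by linarith

theorem pruneAt (h : IsViable A B H pending M) (hH : Decomposes A B H) (hx : x.side = .inA)
    (hpending : x ∈ pending) : IsViable A B H pending (M.pruneAt x) where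
  toIsBipartite := h.toIsBipartite.pruneAt x
  cover v hv hvA a ha b hb hmin := by
    obtain ⟨y, hy, hby⟩ := h.cover v hv hvA a ha b hb hmin
    refine ⟨y, (h.mem_adj_pruneAt hx hvA).2 ⟨hy, ?_⟩, hby⟩
    rintro rfl
    exact h.lowerDist_le_pruneThreshold hH hx ha hmin hy hby
  isPruned v hv hvA hvp y hy y' hy' :=
    h.isPruned v hv hvA hvp y (Memory.mem_adj_pruneAt.1 hy).1 y' (Memory.mem_adj_pruneAt.1 hy').1
  low v hv hvA hvp := by
    obtain ⟨y, hy, hlow⟩ := h.low v hv hvA hvp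
    exact ⟨y, (h.mem_adj_pruneAt hx hvA).2 ⟨hy, fun e => absurd (e ▸ hpending) hvp⟩, hlow⟩
  best_nonneg := h.best_nonneg
  best_le := h.best_le

theorem exists_mem_adj (h : IsViable A B H pending M) (hH : Decomposes A B H) (hB : B.Nonempty)
    (hxH : x ∈ H) (hx : x.side = .inA) :
    ∃ b, (∀ b' ∈ B, dist x.tree.center b ≤ dist x.tree.center b') ∧
      ∃ y ∈ M.adj x, b ∈ y.tree.leaves := by
  obtain ⟨b, hb, hmin⟩ := B.exists_min_image (dist x.tree.center) hB
  exact ⟨b, hmin, h.cover x hxH hx _ (hH.center_mem_leaves hxH) b hb hmin⟩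

theorem updateAt (h : IsViable A B H (x :: pending) M) (hH : Decomposes A B H) (hB : B.Nonempty)
    (hxH : x ∈ H) (hx : x.side = .inA) (hprune : M.IsPruned x) :
    IsViable A B H pending (M.updateAt x) := by
  obtain ⟨b, hmin, y, hy, hby⟩ := h.exists_mem_adj hH hB hxH hx
  have hlocal : M.localBound x ≤ dist x.tree.center b :=
    (Memory.localBound_le hy).trans (max_le (Vertex.lowerDist_le_dist hby) dist_nonneg)
  refine ⟨⟨h.mem, h.symm, h.side_ne, h.nodup⟩, h.cover, fun v hv hvA hvp => ?_,
    fun v hv hvA hvp => ?_, h.best_nonneg.trans (le_max_left _ _), ?_⟩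
  · rcases eq_or_ne v x with rfl | hvx
    · exact hprune
    · exact h.isPruned v hv hvA (List.not_mem_cons_of_ne_of_not_mem hvx hvp)
  · rcases eq_or_ne v x with rfl | hvx
    · obtain ⟨w, hw, hlow⟩ := Memory.exists_lowerDist_le_localBound hy
      exact ⟨w, hw, hlow.trans (le_max_right _ _)⟩
    · obtain ⟨w, hw, hlow⟩ := h.low v hv hvA (List.not_mem_cons_of_ne_of_not_mem hvx hvp)
      exact ⟨w, hw, hlow.trans (le_max_left _ _)⟩
  · rcases max_choice M.best (M.localBound x) with hbest | hbest
    · obtain ⟨a, ha, hle⟩ := h.best_le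
      exact ⟨a, ha, fun b' hb' => hbest.trans_le (hle b' hb')⟩
    · exact ⟨_, hH.center_mem_left hxH hx, fun b' hb' =>
        hbest.trans_le (hlocal.trans (hmin b' hb'))⟩

theorem refine (h : IsViable A B H (x :: pending) M) (hH : Decomposes A B H) (hB : B.Nonempty)
    (hxH : x ∈ H) (hx : x.side = .inA) : IsViable A B H pending (M.refine x) :=
  (h.pruneAt hH hx List.mem_cons_self).updateAt hH hB hxH hx (Memory.isPruned_pruneAt x M)

theorem foldl_refine (h : IsViable A B H pending M) (hH : Decomposes A B H) (hB : B.Nonempty)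
    (hpending : ∀ x ∈ pending, x ∈ H ∧ x.side = .inA) :
    IsViable A B H [] (pending.foldl Memory.refine M) := by
  induction pending generalizing M with
  | nil => exact h
  | cons x pending ih =>
    obtain ⟨⟨hxH, hx⟩, hrest⟩ := List.forall_mem_cons.1 hpending
    exact ih (h.refine hH hB hxH hx) hrest

variable {z zl zr : Vertex X}

theorem cover_split (h : IsViable A B (z ::ₘ H) [] M) (hs : z.IsSplit zl zr) (hz : z ∉ H)
    (hH : (zl ::ₘ zr ::ₘ H).Nodup) (hx : x ∈ zl ::ₘ zr ::ₘ H) (hxA : x.side = .inA) {a b : X}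
    (ha : a ∈ x.tree.leaves) (hb : b ∈ B) (hmin : ∀ b' ∈ B, dist a b ≤ dist a b') :
    ∃ y ∈ (M.split z zl zr).adj x, b ∈ y.tree.leaves := by
  have hxz : x ≠ z := by
    rintro rfl
    simp [hs.left_ne.symm, hs.right_ne.symm, hz] at hx
  obtain ⟨y, hy, hby⟩ := h.cover _ (Vertex.parent_mem hx) ((hs.side_parent x).trans hxA) a
    (hs.mem_leaves_parent ha) b hb hmin
  have hmem {y' : Vertex X} (hy' : Vertex.parent z zl zr y' = y) (hne : y' ≠ z) :
      y' ∈ (M.split z zl zr).adj x :=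
    (h.mem_adj_split hs hH).2 ⟨hxz, hne, hy' ▸ hy⟩
  rcases eq_or_ne y z with rfl | hyz
  · rw [hs.leaves_eq, Multiset.mem_add] at hby
    rcases hby with hby | hby
    · exact ⟨zl, hmem Vertex.parent_left hs.left_ne, hby⟩
    · exact ⟨zr, hmem Vertex.parent_right hs.right_ne, hby⟩
  · have hyl : y ≠ zl := fun e => h.left_notMem_adj hs hH _ (e ▸ hy)
    have hyr : y ≠ zr := fun e => h.right_notMem_adj hs hH _ (e ▸ hy)
    exact ⟨y, hmem (Vertex.parent_of_ne hyl hyr) hyz, hby⟩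

theorem split (h : IsViable A B (z ::ₘ H) [] M) (hs : z.IsSplit zl zr) (hz : z ∉ H)
    (hH : (zl ::ₘ zr ::ₘ H).Nodup) :
    IsViable A B (zl ::ₘ zr ::ₘ H) (M.affected z zl zr) (M.split z zl zr) := by
  have hunaffected : ∀ x ∈ zl ::ₘ zr ::ₘ H, x.side = .inA → x ∉ M.affected z zl zr →
      x ∈ z ::ₘ H ∧ (M.split z zl zr).adj x = M.adj x := by
    intro x hx hxA hS
    obtain ⟨hadj, hl, hr⟩ := h.notMem_of_notMem_affected hs hxA hS
    have hxH : x ∈ H := by simpa [hl, hr] using hx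
    have hxz : x ≠ z := fun e => hz (e ▸ hxH)
    refine ⟨Multiset.mem_cons_of_mem hxH, ?_⟩
    rw [Memory.adj_split (h.isGraph.irrefl z) (h.left_notMem_adj hs hH z)
      (h.right_notMem_adj hs hH z), if_neg hxz, if_neg hadj, if_neg (not_or.2 ⟨hl, hr⟩)]
  refine ⟨h.toIsBipartite.split hs hH, fun x hx hxA a ha b hb hmin =>
    h.cover_split hs hz hH hx hxA ha hb hmin, fun x hx hxA hS => ?_, fun x hx hxA hS => ?_,
    h.best_nonneg, h.best_le⟩
  · obtain ⟨hxH, hadj⟩ := hunaffected x hx hxA hS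
    unfold Memory.IsPruned
    rw [hadj]
    exact h.isPruned x hxH hxA List.not_mem_nil
  · obtain ⟨hxH, hadj⟩ := hunaffected x hx hxA hS
    rw [hadj]
    exact h.low x hxH hxA List.not_mem_nil

end IsViable

/-! ### Accuracy and degrees of the viability graph -/

theorem IsBipartite.degreeLE_card {X : Type u} {H : Multiset (Vertex X)} {M : Memory X}
    (h : IsBipartite H M) : M.DegreeLE H.card := fun v =>
  Multiset.card_le_card
    ((Multiset.le_iff_subset (Multiset.coe_nodup.2 (h.nodup v))).2 fun _ hw => h.mem hw)

namespace IsViable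

variable {X : Type u} [MetricSpace X] {A B : Finset X} {H : Multiset (Vertex X)} {M : Memory X}
  {r : ℝ}

theorem exists_dist_le (h : IsViable A B H [] M) (hH : Decomposes A B H)
    (hr : ∀ v ∈ H, v.tree.radius ≤ r) {a : X} (ha : a ∈ A) :
    ∃ b ∈ B, dist a b ≤ M.best + 2 * r := by
  obtain ⟨x, hxH, hx, hax⟩ := hH.exists_mem_leaves ha
  obtain ⟨y, hy, hlow⟩ := h.low x hxH hx List.not_mem_nil
  refine ⟨y.tree.center, hH.center_mem_right (h.mem hy) (h.side_eq_inB hx hy), ?_⟩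
  calc dist a y.tree.center ≤ dist x.tree.center a + x.ctrDist y := dist_triangle_left _ _ _
    _ ≤ x.tree.radius + (x.lowerDist y + y.tree.radius) :=
        add_le_add (BallTree.dist_center_le_radius hax) (sub_add_cancel _ _).ge
    _ ≤ M.best + 2 * r := by linarith [hr x hxH, hr y (h.mem hy)]

theorem ctrDist_le (h : IsViable A B H [] M) (hr : ∀ v ∈ H, v.tree.radius ≤ r) {x y : Vertex X}
    (hx : x.side = .inA) (hy : y ∈ M.adj x) : x.ctrDist y ≤ M.best + 4 * r := by
  have hxH := h.mem (h.symm hy)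
  obtain ⟨y', hy', hlow⟩ := h.low x hxH hx List.not_mem_nil
  have hprune := h.isPruned x hxH hx List.not_mem_nil y hy y' hy'
  unfold Vertex.lowerDist at hprune hlow
  linarith [hr x hxH, hr y (h.mem hy), hr y' (h.mem hy')]

theorem dist_center_le (h : IsViable A B H [] M) (hr : ∀ v ∈ H, v.tree.radius ≤ r)
    {v w : Vertex X} (hw : w ∈ M.adj v) :
    dist w.tree.center v.tree.center ≤ M.best + 4 * r := by
  cases hv : v.side with
  | inA => exact dist_comm v.tree.center _ ▸ h.ctrDist_le hr hv hw
  | inB => exact h.ctrDist_le hr (h.side_eq_inA hv hw) (h.symm hw)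

/-- Unless the loop stops, `best < 2 * r / ε`, so the neighbours of `v` have their centers in a ball
of radius `(2 / ε + 4) * r`, and these are `r / (2 * κ)` apart. -/
theorem length_adj_le (h : IsViable A B H [] M) (hH : Decomposes A B H) {d κ ρ ε : ℝ}
    {p : Side → ℕ → X} (hspaced : IsSpaced p κ ρ H) (hd : HalfRadiusCover X d) (hκ : 1 ≤ κ)
    (hε : 0 < ε) (hr : ∀ v ∈ H, v.tree.radius ≤ r) (hr0 : 0 < r) (hrρ : r ≤ 2 * κ * ρ)
    (hbest : ε * M.best / 2 < r) (v : Vertex X) :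
    ((M.adj v).length : ℝ) ≤ (16 * κ * (2 + 1 / ε)) ^ d := by
  classical
  have hs0 : 0 < r / (2 * κ) := by positivity
  have hsep : ∀ w ∈ M.adj v, ∀ w' ∈ M.adj v, w ≠ w' →
      r / (2 * κ) ≤ dist w.tree.center w'.tree.center := fun w hw w' hw' hne => by
    have hside : w.side = w'.side := by
      cases hv : v.side with
      | inA => exact (h.side_eq_inB hv hw).trans (h.side_eq_inB hv hw').symm
      | inB => exact (h.side_eq_inA hv hw).trans (h.side_eq_inA hv hw').symm
    exact ((div_le_iff₀' (by positivity)).2 hrρ).trans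
      (hspaced.le_dist_center hH (h.mem hw) (h.mem hw') hside hne)
  have hinj : Set.InjOn (fun w : Vertex X => w.tree.center) (M.adj v).toFinset := by
    intro w hw w' hw' hcenter
    by_contra hne
    have hdist := hsep w (by simpa using hw) w' (by simpa using hw') hne
    exact (hs0.trans_le hdist).ne' (dist_eq_zero.2 hcenter)
  have hball : M.best + 4 * r ≤ (2 / ε + 4) * r := by
    have : M.best ≤ 2 / ε * r := by
      rw [div_mul_eq_mul_div, le_div_iff₀ hε]
      linarith
    linarith
  have hq : 1 ≤ 2 * (2 * κ * (2 / ε + 4)) := by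
    have : 0 < 2 / ε := by positivity
    nlinarith
  rw [← List.toFinset_card_of_nodup (h.nodup v), ← Finset.card_image_of_injOn hinj,
    show 16 * κ * (2 + 1 / ε) = 4 * (2 * κ * (2 / ε + 4)) by ring]
  refine hd.card_le_of_separated (c := v.tree.center) (r := (2 / ε + 4) * r)
    (s := r / (2 * κ)) (by positivity) hs0 hq (by field_simp; rfl) ?_ ?_
  · simp only [Finset.forall_mem_image, List.mem_toFinset]
    exact fun w hw => (h.dist_center_le hr hw).trans hball
  · simp only [Finset.coe_image, List.coe_toFinset]
    rintro _ ⟨w, hw, rfl⟩ _ ⟨w', hw', rfl⟩ hne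
    exact hsep w hw w' hw' fun e => hne (by rw [e])

end IsViable

/-! ### The main loop -/

namespace Memory

variable {X : Type u} {z zl zr : Vertex X} {M : Memory X}

theorem DegreeLE.length_affected_le {D : ℕ} (hM : M.DegreeLE D) :
    (M.affected z zl zr).length ≤ D + 2 := by
  unfold affected
  split
  · simp
  · exact (hM z).trans (Nat.le_add_right D 2)

/-- The effect of one iteration of the main loop. -/
noncomputable def step [MetricSpace X] (z zl zr : Vertex X) (M : Memory X) : Memory X :=
  (M.affected z zl zr).foldl Memory.refine (M.split z zl zr)

end Memory

theorem IsViable.step {X : Type u} [MetricSpace X] {A B : Finset X} {H : Multiset (Vertex X)}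
    {z zl zr : Vertex X} {M : Memory X} (h : IsViable A B (z ::ₘ H) [] M) (hs : z.IsSplit zl zr)
    (hB : B.Nonempty) (hH : Decomposes A B (z ::ₘ H)) (hH' : Decomposes A B (zl ::ₘ zr ::ₘ H)) :
    IsViable A B (zl ::ₘ zr ::ₘ H) [] (M.step z zl zr) :=
  (h.split hs (Multiset.nodup_cons.1 hH.nodup).1 hH'.nodup).foldl_refine hH' hB
    fun _ hx => h.mem_of_mem_affected hs hx

section DirectedHausdorff

variable {X : Type u} [MetricSpace X] {A B : Finset X} {hA : A.Nonempty} {hB : B.Nonempty} {r : ℝ}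

theorem le_directedHausdorff_iff :
    r ≤ directedHausdorff A B hA hB ↔ ∃ a ∈ A, ∀ b ∈ B, r ≤ dist a b := by
  simp only [directedHausdorff, Finset.le_sup'_iff, Finset.le_inf'_iff]

theorem directedHausdorff_le_iff :
    directedHausdorff A B hA hB ≤ r ↔ ∀ a ∈ A, ∃ b ∈ B, dist a b ≤ r := by
  simp only [directedHausdorff, Finset.sup'_le_iff, Finset.inf'_le_iff]

end DirectedHausdorff

namespace Hausdorff

variable {X : Type u}

theorem affected_eq (z zl zr : Vertex X) (M M' : Memory X) :
    ∃ c ≤ 3, affected z zl zr (M.adj z) M' = (M.affected z zl zr, M', c) := by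
  cases hz : z.side
  · exact ⟨3, le_rfl, by simp [affected, Memory.affected, hz, Comp.bind, getSide, prepend,
      Comp.query, Comp.instr]⟩
  · exact ⟨1, by lia, by simp [affected, Memory.affected, hz, Comp.bind, getSide, Comp.ret,
      Comp.query, Comp.instr]⟩

variable [MetricSpace X] {A B : Finset X} {H : Multiset (Vertex X)} {ε : ℝ}
  {zs : List (Vertex X)} {M : Memory X}

theorem mainLoop_nil (ε : ℝ) (M : Memory X) : mainLoop ε [] M = (M.best, M, 2) := rfl

theorem mainLoop_cons_of_le {z : Vertex X} (h : z.tree.radius ≤ ε * M.best / 2) :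
    mainLoop ε (z :: zs) M = (M.best, M, 6) := by
  simp [mainLoop, Comp.bind, tick, Comp.query, Comp.instr, getRadius, getBest, mul, half, atMost, h,
    Comp.ret]

theorem mainLoop_cons_of_lt {s : Side} {c : X} {l r : BallTree X} {D : ℕ}
    (hlt : ε * M.best / 2 < (BallTree.node c l r).radius) (hM : M.IsGraph) (hD : M.DegreeLE D)
    (hsplit : (M.split ⟨s, .node c l r⟩ ⟨s, l⟩ ⟨s, r⟩).IsGraph) :
    ∃ k ≤ 30 * (D + 2) ^ 3,
      (mainLoop ε (⟨s, .node c l r⟩ :: zs) M).1 =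
        (mainLoop ε zs (M.step ⟨s, .node c l r⟩ ⟨s, l⟩ ⟨s, r⟩)).1 ∧
      (mainLoop ε (⟨s, .node c l r⟩ :: zs) M).2.2 =
        k + (mainLoop ε zs (M.step ⟨s, .node c l r⟩ ⟨s, l⟩ ⟨s, r⟩)).2.2 := by
  obtain ⟨c₁, hc₁, hrun₁⟩ := splitVertex_eq (z := ⟨s, .node c l r⟩) (zl := ⟨s, l⟩)
    (zr := ⟨s, r⟩) hD (hM.nodup _)
  obtain ⟨c₂, hc₂, hrun₂⟩ := affected_eq ⟨s, .node c l r⟩ ⟨s, l⟩ ⟨s, r⟩ M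
    (M.split ⟨s, .node c l r⟩ ⟨s, l⟩ ⟨s, r⟩)
  obtain ⟨c₃, hc₃, hrun₃⟩ :=
    forEach_refine_eq (M.affected ⟨s, .node c l r⟩ ⟨s, l⟩ ⟨s, r⟩) hsplit hD.split
  refine ⟨7 + (c₁ + (c₂ + c₃)), ?_, ?_⟩
  · have hlen : ((3 * (D + 2) + 22) * (D + 2) + 15) *
          (M.affected ⟨s, .node c l r⟩ ⟨s, l⟩ ⟨s, r⟩).length ≤
        ((3 * (D + 2) + 22) * (D + 2) + 15) * (D + 2) :=
      Nat.mul_le_mul_left _ hD.length_affected_le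
    nlinarith
  · have hcontinue : atMost (BallTree.node c l r).radius (ε * M.best / 2) M = (false, M, 1) := by
      simp [atMost, Comp.query, Comp.instr, hlt]
    have hchildren : (getChildren ⟨s, .node c l r⟩ : Comp X _) M =
        (some (⟨s, l⟩, ⟨s, r⟩), M, 1) := rfl
    simp only [mainLoop, Comp.bind, tick, Comp.query, Comp.instr, getRadius, getBest, mul, half,
      hcontinue, Bool.false_eq_true, ↓reduceIte, hchildren, hrun₁, hrun₂, hrun₃, Memory.step,
      true_and]
    ring

theorem mainLoop_bounds (hA : A.Nonempty) (hB : B.Nonempty) (hε : 0 ≤ ε) (hzs : RadiusOrder H zs)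
    (hH : Decomposes A B H) (h : IsViable A B H [] M) :
    (mainLoop ε zs M).1 ≤ directedHausdorff A B hA hB ∧
      directedHausdorff A B hA hB ≤ (1 + ε) * (mainLoop ε zs M).1 := by
  induction hzs generalizing M with
  | done H hzero =>
    refine ⟨le_directedHausdorff_iff.2 h.best_le, directedHausdorff_le_iff.2 fun a ha => ?_⟩
    obtain ⟨b, hb, hab⟩ := h.exists_dist_le hH (fun v hv => (hzero v hv).le) ha
    refine ⟨b, hb, hab.trans ?_⟩
    rw [mainLoop_nil]
    linarith [mul_nonneg hε h.best_nonneg]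
  | pop H s c l r zs _ hmax _ ih =>
    rcases le_or_gt (BallTree.node c l r).radius (ε * M.best / 2) with hle | hlt
    · rw [mainLoop_cons_of_le hle]
      refine ⟨le_directedHausdorff_iff.2 h.best_le, directedHausdorff_le_iff.2 fun a ha => ?_⟩
      obtain ⟨b, hb, hab⟩ := h.exists_dist_le hH (Multiset.forall_mem_cons.2 ⟨le_rfl, hmax⟩) ha
      exact ⟨b, hb, by linarith⟩
    · have hs := Vertex.isSplit_node s c l r
      obtain ⟨k, -, hloop, -⟩ := mainLoop_cons_of_lt (zs := zs) hlt h.isGraph h.degreeLE_card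
        (h.toIsBipartite.split hs hH.pop.nodup).isGraph
      rw [hloop]
      exact ih hH.pop (h.step hs hB hH hH.pop)

theorem mainLoop_cost_le {d κ ρ : ℝ} {p : Side → ℕ → X} (hd : HalfRadiusCover X d)
    (hB : B.Nonempty) (hκ : 1 ≤ κ) (hε : 0 < ε) (hzs : RadiusOrder H zs) (hH : Decomposes A B H)
    (hspaced : IsSpaced p κ ρ H) (h : IsViable A B H [] M) :
    (mainLoop ε zs M).2.2 ≤
      30 * (⌊(16 * κ * (2 + 1 / ε)) ^ d⌋₊ + 2) ^ 3 * zs.length + 6 := by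
  induction hzs generalizing ρ M with
  | done => simp [mainLoop_nil]
  | pop H s c l r zs hpos hmax _ ih =>
    rcases le_or_gt (BallTree.node c l r).radius (ε * M.best / 2) with hle | hlt
    · rw [mainLoop_cons_of_le (z := ⟨s, .node c l r⟩) hle]
      exact Nat.le_add_left _ _
    · have hs := Vertex.isSplit_node s c l r
      have hD : M.DegreeLE ⌊(16 * κ * (2 + 1 / ε)) ^ d⌋₊ := fun v => Nat.le_floor
        (h.length_adj_le hH hspaced hd hκ hε (Multiset.forall_mem_cons.2 ⟨le_rfl, hmax⟩)
          ((BallTree.radius_nonneg _).lt_of_ne' hpos)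
          (hspaced.radius_le hH (Multiset.mem_cons_self _ _)) hlt v)
      obtain ⟨k, hk, -, hloop⟩ := mainLoop_cons_of_lt (zs := zs) hlt h.isGraph hD
        (h.toIsBipartite.split hs hH.pop.nodup).isGraph
      have hcenter : l.center = c := (hH.isCentered _ (Multiset.mem_cons_self _ _)).1
      have hrest := ih hH.pop (hspaced.pop (by linarith) hcenter hmax) (h.step hs hB hH hH.pop)
      rw [hloop, List.length_cons, mul_add_one]
      lia

end Hausdorff

/-! ### The whole program -/

namespace Memory

variable {X : Type u} {x y : Vertex X}

/-- The memory that holds a single edge. -/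
noncomputable def edge (x y : Vertex X) : Memory X :=
  ((Hausdorff.blank X).write x [y]).write y [x]

theorem mem_adj_edge (hxy : x ≠ y) {v w : Vertex X} :
    w ∈ (edge x y).adj v ↔ v = x ∧ w = y ∨ v = y ∧ w = x := by
  rcases eq_or_ne v y with rfl | hvy
  · simp [edge, write, hxy.symm]
  rcases eq_or_ne v x with rfl | hvx <;> simp [edge, write, Hausdorff.blank, *]

theorem length_adj_edge_le (x y v : Vertex X) : ((edge x y).adj v).length ≤ 1 := by
  rcases eq_or_ne v y with rfl | hvy
  · simp [edge, write]
  rcases eq_or_ne v x with rfl | hvx <;> simp [edge, write, Hausdorff.blank, *]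

/-- The memory with which the main loop starts. -/
noncomputable def initial [MetricSpace X] (GA GB : BallTree X) : Memory X :=
  (edge ⟨.inA, GA⟩ ⟨.inB, GB⟩).updateAt ⟨.inA, GA⟩

theorem isPruned_edge [MetricSpace X] (hxy : x ≠ y) : (edge x y).IsPruned x := by
  intro w hw w' hw'
  simp only [mem_adj_edge hxy, true_and, hxy, false_and, or_false] at hw hw'
  rw [hw, hw']
  unfold Vertex.lowerDist
  linarith [x.tree.radius_nonneg, y.tree.radius_nonneg]

end Memory

theorem isBipartite_edge {X : Type u} {x y : Vertex X} (hxy : x.side ≠ y.side) :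
    IsBipartite {x, y} (Memory.edge x y) := by
  have hne : x ≠ y := fun h => hxy (h ▸ rfl)
  refine ⟨fun {v w} h => ?_, fun {v w} h => ?_, fun {v w} h => ?_, fun v => ?_⟩
  case refine_4 =>
    classical
    exact List.nodup_iff_count_le_one.2 fun w =>
      List.count_le_length.trans (Memory.length_adj_edge_le x y v)
  all_goals rcases (Memory.mem_adj_edge hne).1 h with ⟨rfl, rfl⟩ | ⟨rfl, rfl⟩
  · exact Multiset.mem_cons_of_mem (Multiset.mem_singleton_self w)
  · exact Multiset.mem_cons_self w _
  · exact (Memory.mem_adj_edge hne).2 (.inr ⟨rfl, rfl⟩)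
  · exact (Memory.mem_adj_edge hne).2 (.inl ⟨rfl, rfl⟩)
  · exact hxy
  · exact hxy.symm

theorem isViable_roots {X : Type u} [MetricSpace X] {α : ℝ} {A B : Finset X} (hA : A.Nonempty)
    {GA GB : BallTree X} (hGB : IsGreedyTree α B GB) :
    IsViable A B {⟨Side.inA, GA⟩, ⟨Side.inB, GB⟩} [⟨Side.inA, GA⟩]
      (Memory.edge ⟨Side.inA, GA⟩ ⟨Side.inB, GB⟩) := by
  have hroot : ∀ x ∈ ({⟨Side.inA, GA⟩, ⟨Side.inB, GB⟩} : Multiset (Vertex X)), x.side = .inA →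
      x = ⟨Side.inA, GA⟩ := by
    simp [Multiset.insert_eq_cons]
  refine ⟨isBipartite_edge (by simp), fun x hxH hx a _ b hb _ => ?_,
    fun x hxH hx hpending => absurd (List.mem_singleton.2 (hroot x hxH hx)) hpending,
    fun x hxH hx hpending => absurd (List.mem_singleton.2 (hroot x hxH hx)) hpending, le_rfl,
    hA.imp fun a ha => ⟨ha, fun b _ => dist_nonneg⟩⟩
  exact ⟨⟨.inB, GB⟩, (Memory.mem_adj_edge (by simp)).2 (.inl ⟨hroot x hxH hx, rfl⟩),
    hGB.leaves_eq ▸ hb⟩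

theorem isViable_initial {X : Type u} [MetricSpace X] {α : ℝ} {A B : Finset X}
    (hA : A.Nonempty) (hB : B.Nonempty) {GA GB : BallTree X} (hGA : IsGreedyTree α A GA)
    (hGB : IsGreedyTree α B GB) :
    IsViable A B {⟨Side.inA, GA⟩, ⟨Side.inB, GB⟩} [] (Memory.initial GA GB) :=
  (isViable_roots hA hGB).updateAt (decomposes_roots hGA hGB) hB (Multiset.mem_cons_self _ _) rfl
    (Memory.isPruned_edge (by simp))

theorem RadiusOrder.length_add_two_le {X : Type u} [MetricSpace X] {α : ℝ} {A B : Finset X}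
    {GA GB : BallTree X} {zs : List (Vertex X)} (hGA : IsGreedyTree α A GA)
    (hGB : IsGreedyTree α B GB) (hzs : RadiusOrder {⟨Side.inA, GA⟩, ⟨Side.inB, GB⟩} zs) :
    zs.length + 2 ≤ A.card + B.card := by
  have h := hzs.length_add_card_le
  rwa [(decomposes_roots hGA hGB).points, Finset.card_val, Finset.card_disjSum] at h

namespace Hausdorff

variable {X : Type u} [MetricSpace X] {A B : Finset X} {GA GB : BallTree X} {α ε : ℝ}
  {zs : List (Vertex X)}

theorem output_eq_and_runningTime_eq (ε : ℝ) (GA GB : BallTree X) (zs : List (Vertex X)) :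
    ∃ c ≤ 19, output ε GA GB zs = (mainLoop ε zs (Memory.initial GA GB)).1 ∧
      runningTime ε GA GB zs = c + (mainLoop ε zs (Memory.initial GA GB)).2.2 := by
  obtain ⟨c, hc, hupdate⟩ :=
    updateLow_eq ⟨.inA, GA⟩ (Memory.edge ⟨.inA, GA⟩ (⟨.inB, GB⟩ : Vertex X))
  have hlen := Memory.length_adj_edge_le ⟨.inA, GA⟩ ⟨.inB, GB⟩ (⟨.inA, GA⟩ : Vertex X)
  have hstart : program ε GA GB zs (blank X) =
      let R := (updateLow ⟨.inA, GA⟩ ≫= fun _ => mainLoop ε zs)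
        (Memory.edge ⟨.inA, GA⟩ ⟨.inB, GB⟩)
      (R.1, R.2.1, 1 + (1 + (1 + (1 + (1 + R.2.2))))) := rfl
  refine ⟨5 + c, by lia, ?_, ?_⟩
  · simp only [output, hstart, Comp.bind, hupdate, Memory.initial]
  · simp only [runningTime, hstart, Comp.bind, hupdate, Memory.initial]
    ring

theorem output_bounds (hA : A.Nonempty) (hB : B.Nonempty) (hGA : IsGreedyTree α A GA)
    (hGB : IsGreedyTree α B GB) (hzs : RadiusOrder {⟨.inA, GA⟩, ⟨.inB, GB⟩} zs) (hε : 0 ≤ ε) :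
    output ε GA GB zs ≤ directedHausdorff A B hA hB ∧
      directedHausdorff A B hA hB ≤ (1 + ε) * output ε GA GB zs := by
  obtain ⟨-, -, houtput, -⟩ := output_eq_and_runningTime_eq ε GA GB zs
  rw [houtput]
  exact mainLoop_bounds hA hB hε hzs (decomposes_roots hGA hGB)
    (isViable_initial hA hB hGA hGB)

theorem runningTime_le {d : ℝ} (hα : 1 < α) (hd : HalfRadiusCover X d) (hA : A.Nonempty)
    (hB : B.Nonempty) (hGA : IsGreedyTree α A GA) (hGB : IsGreedyTree α B GB)
    (hzs : RadiusOrder {⟨.inA, GA⟩, ⟨.inB, GB⟩} zs) (hε : 0 < ε) :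
    (runningTime ε GA GB zs : ℝ) ≤
      30 * ((16 * (α ^ 3 / (α - 1)) * (2 + 1 / ε)) ^ d + 2) ^ 3 * (A.card + B.card) := by
  obtain ⟨p, ρ, hspaced⟩ := exists_isSpaced_roots hα hGA hGB
  obtain ⟨c, hc, -, htime⟩ := output_eq_and_runningTime_eq ε GA GB zs
  have hκ : 1 ≤ α ^ 3 / (α - 1) := by
    rw [le_div_iff₀ (by linarith)]
    nlinarith [sq_nonneg α]
  have hloop := mainLoop_cost_le hd hB hκ hε hzs (decomposes_roots hGA hGB) hspaced
    (isViable_initial hA hB hGA hGB)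
  have hlen := hzs.length_add_two_le hGA hGB
  set F := (16 * (α ^ 3 / (α - 1)) * (2 + 1 / ε)) ^ d
  have hF : (⌊F⌋₊ : ℝ) ≤ F := Nat.floor_le (by positivity)
  have hnat : runningTime ε GA GB zs ≤ 30 * (⌊F⌋₊ + 2) ^ 3 * (A.card + B.card) := by
    have : 1 ≤ (⌊F⌋₊ + 2) ^ 3 := Nat.one_le_pow _ _ (by lia)
    calc runningTime ε GA GB zs ≤ 30 * (⌊F⌋₊ + 2) ^ 3 * (zs.length + 2) := by lia
      _ ≤ _ := by gcongr
  calc (runningTime ε GA GB zs : ℝ) ≤ 30 * ((⌊F⌋₊ : ℝ) + 2) ^ 3 * (A.card + B.card) := by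
        exact_mod_cast hnat
    _ ≤ 30 * (F + 2) ^ 3 * (A.card + B.card) := by gcongr

end Hausdorff

theorem exists_mul_rpow_add_two_cube_le {c κ : ℝ} (hc : 0 ≤ c) (hκ : 0 < κ) :
    ∃ C : ℝ, 0 < C ∧ ∀ u d : ℝ, 2 ≤ u → 0 ≤ d →
      c * ((κ * u) ^ d + 2) ^ 3 ≤ C * u ^ (C * d) := by
  obtain ⟨k, hk⟩ := pow_unbounded_of_one_lt κ (one_lt_two : (1 : ℝ) < 2)
  refine ⟨3 * (k + 1) + 27 * c, by positivity, fun u d hu hd => ?_⟩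
  have hpow : (κ * u) ^ d ≤ u ^ ((k + 1) * d) := by
    rw [Real.rpow_mul (by positivity), Real.rpow_add_one (by positivity), Real.rpow_natCast]
    gcongr
    exact hk.le.trans (by gcongr)
  have hone : 1 ≤ u ^ ((k + 1) * d) := Real.one_le_rpow (by linarith) (by positivity)
  calc c * ((κ * u) ^ d + 2) ^ 3 ≤ c * (3 * u ^ ((k + 1) * d)) ^ 3 := by
        gcongr
        linarith
    _ = 27 * c * u ^ ((k + 1) * d * 3) := by
        rw [Real.rpow_mul (by positivity) _ 3, mul_pow, ← Real.rpow_natCast (u ^ _) 3]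
        norm_num
        ring
    _ ≤ (3 * (k + 1) + 27 * c) * u ^ ((3 * (k + 1) + 27 * c) * d) :=
        mul_le_mul (le_add_of_nonneg_left (by positivity))
          (Real.rpow_le_rpow_of_exponent_le (by linarith) (by nlinarith)) (by positivity)
          (by positivity)

theorem theorem4p3_general (α : ℝ) (hα : 1 < α) :
    ∃ C : ℝ, 0 < C ∧
      ∀ (X : Type u) [MetricSpace X] (A B : Finset X) (hA : A.Nonempty) (hB : B.Nonempty)
        (GA GB : BallTree X), IsGreedyTree α A GA → IsGreedyTree α B GB →
      ∀ zs : List (Vertex X), RadiusOrder {⟨Side.inA, GA⟩, ⟨Side.inB, GB⟩} zs →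
      ∀ ε : ℝ, 0 < ε →
        Hausdorff.output ε GA GB zs ≤ directedHausdorff A B hA hB ∧
        directedHausdorff A B hA hB ≤ (1 + ε) * Hausdorff.output ε GA GB zs ∧
        ∀ d : ℝ, HalfRadiusCover X d →
          (Hausdorff.runningTime ε GA GB zs : ℝ) ≤
            C * (2 + 1 / ε) ^ (C * d) * ((A.card : ℝ) + (B.card : ℝ)) := by
  obtain ⟨C, hC, hbound⟩ := exists_mul_rpow_add_two_cube_le (c := 30)
    (κ := 16 * (α ^ 3 / (α - 1))) (by norm_num)
    (mul_pos (by norm_num) (div_pos (by positivity) (by linarith)))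
  refine ⟨C, hC, fun X _ A B hA hB GA GB hGA hGB zs hzs ε hε => ?_⟩
  obtain ⟨hlower, hupper⟩ := Hausdorff.output_bounds hA hB hGA hGB hzs hε.le
  refine ⟨hlower, hupper, fun d hd => ?_⟩
  have : Nonempty X := ⟨hA.choose⟩
  refine (Hausdorff.runningTime_le hα hd hA hB hGA hGB hzs hε).trans ?_
  exact mul_le_mul_of_nonneg_right
    (hbound _ d (le_add_of_nonneg_right (by positivity)) hd.nonneg) (by positivity)

theorem theorem4p3 (α : ℝ) (hα : 1 < α) :
    ∃ C : ℝ, 0 < C ∧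
      ∀ (X : Type u) [MetricSpace X] (d : ℝ), IsDoublingDimension X d →
      ∀ (A B : Finset X) (hA : A.Nonempty) (hB : B.Nonempty) (GA GB : BallTree X),
        IsGreedyTree α A GA → IsGreedyTree α B GB →
      ∀ zs : List (Vertex X), RadiusOrder {⟨Side.inA, GA⟩, ⟨Side.inB, GB⟩} zs →
      ∀ ε : ℝ, 0 < ε →
        Hausdorff.output ε GA GB zs ≤ directedHausdorff A B hA hB ∧
        directedHausdorff A B hA hB ≤ (1 + ε) * Hausdorff.output ε GA GB zs ∧
        (Hausdorff.runningTime ε GA GB zs : ℝ) ≤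
          C * (2 + 1 / ε) ^ (C * d) * ((A.card : ℝ) + (B.card : ℝ)) := by
  obtain ⟨C, hC, hmain⟩ := theorem4p3_general α hα
  exact ⟨C, hC, fun X _ d hd A B hA hB GA GB hGA hGB zs hzs ε hε =>
    (hmain X A B hA hB GA GB hGA hGB zs hzs ε hε).imp_right (·.imp_right fun h => h d hd.1)⟩
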